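/- For $\alpha>0$ let $E_\alpha(x)=\sum_{n\ge 0}\frac{x^n}{\Gamma(1+\alpha n)}$ be the Mittag-Leffler function. A function $f$ on $(0,\infty)$ is called completely monotone if it is smooth and $(-1)^n f^{(n)}(x)\ge 0$ for all $n\ge 0$ and $x>0$; a Bernstein measure of $f$ is a positive $\sigma$-finite measure $\mu$ on $[0,\infty)$ with $f(x)=\int_{[0,\infty)} e^{-xt}\,\mu(dt)$ for all $x>0$. For $\beta\in(0,1]$ let ${\bf Z}_\beta$ denote a standard positive $\beta$-stable random variable, that is, a positive random variable whose law is determined by $\mathbb{E}[e^{-\lambda {\bf Z}_\beta}]=e^{-\lambda^\beta}$ for all $\lambda\ge 0$ (so ${\bf Z}_1=1$ almost surely). Let $\alpha\in(0,1)$. The function $$f_\alpha(x)=\frac{e^{x^{1/\alpha}}}{\alpha}-E_\alpha(x),\qquad x>0,$$ is completely monotone if and only if $\alpha\ge 1/2$. Moreover, if $\alpha\ge 1/2$, then the positive stable laws of indices $\frac{1-\alpha}{\alpha}$ and $1-\alpha$ exist, and, taking ${\bf Z}_{(1-\alpha)/\alpha}$ and ${\bf Z}_{1-\alpha}$ independent,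 the function $f_\alpha$ has one and only one Bernstein measure, namely $\left(\frac1\alpha-1\right)$ times the law of $${\bf W}_\alpha=\left(\frac{{\bf Z}_{(1-\alpha)/\alpha}}{{\bf Z}_{1-\alpha}}\right)^{1-\alpha};$$ equivalently, $f_\alpha(x)=\left(\frac1\alpha-1\right)\mathbb{E}[e^{-x{\bf W}_\alpha}]$ for all $x>0$. -/

import Mathlib

open Set MeasureTheory ProbabilityTheory
open scoped ContDiff

/-- The Mittag-Leffler function `E_α(x) = ∑_{n ≥ 0} x ^ n / Γ(1 + α n)` at real arguments. -/
noncomputable def mittagLeffler (α x : ℝ) : ℝ :=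
  ∑' n : ℕ, x ^ n / Real.Gamma (1 + α * n)

/-- `Γ(1 + s) ≥ R ^ s e ^ {-R}` for `s ≥ 0` and `R > 0`. -/
theorem rpow_mul_exp_neg_le_Gamma {R s : ℝ} (hR : 0 < R) (hs : 0 ≤ s) :
    R ^ s * Real.exp (-R) ≤ Real.Gamma (1 + s) := by
  have h1 : (0 : ℝ) < 1 + s := by linarith
  rw [Real.Gamma_eq_integral h1, ← integral_exp_neg_Ioi R, ← integral_const_mul]
  have hint := Real.GammaIntegral_convergent h1
  have hsub : Ioi R ⊆ Ioi (0 : ℝ) := Ioi_subset_Ioi hR.le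
  calc ∫ t in Ioi R, R ^ s * Real.exp (-t)
      ≤ ∫ t in Ioi R, Real.exp (-t) * t ^ (1 + s - 1) := by
        refine setIntegral_mono_on ((integrableOn_exp_neg_Ioi R).const_mul _)
          (hint.mono_set hsub) measurableSet_Ioi fun t ht => ?_
        rw [mul_comm, add_sub_cancel_left]
        exact mul_le_mul_of_nonneg_left
          (Real.rpow_le_rpow hR.le (le_of_lt ht) hs) (Real.exp_pos _).le
    _ ≤ ∫ t in Ioi (0 : ℝ), Real.exp (-t) * t ^ (1 + s - 1) := by
        refine setIntegral_mono_set hint ?_ hsub.eventuallyLE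
        filter_upwards [self_mem_ae_restrict measurableSet_Ioi] with t ht
        have ht' : (0 : ℝ) < t := ht
        exact mul_nonneg (Real.exp_pos _).le (Real.rpow_nonneg ht'.le _)

/-- The Mittag-Leffler series converges everywhere when `α > 0`. -/
theorem summable_mittagLeffler {α : ℝ} (hα : 0 < α) (x : ℝ) :
    Summable fun n : ℕ => x ^ n / Real.Gamma (1 + α * n) := by
  set R : ℝ := (2 * (|x| + 1)) ^ (1 / α) with hRdef
  have hb : (0 : ℝ) < 2 * (|x| + 1) := by positivity
  have hR : 0 < R := Real.rpow_pos_of_pos hb _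
  have hRα : R ^ α = 2 * (|x| + 1) := by
    rw [hRdef, ← Real.rpow_mul hb.le, one_div_mul_cancel hα.ne', Real.rpow_one]
  have hg : Summable fun n : ℕ => Real.exp R * (1 / 2 : ℝ) ^ n :=
    (summable_geometric_of_lt_one (by norm_num) (by norm_num)).mul_left _
  refine Summable.of_norm_bounded hg fun n => ?_
  have hs : 0 ≤ α * n := by positivity
  have hG := rpow_mul_exp_neg_le_Gamma hR hs
  have hGpos : 0 < Real.Gamma (1 + α * n) := Real.Gamma_pos_of_pos (by linarith)
  rw [Real.rpow_mul hR.le, Real.rpow_natCast, hRα] at hG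
  rw [Real.norm_eq_abs, abs_div, abs_of_pos hGpos, abs_pow, div_le_iff₀ hGpos]
  calc |x| ^ n ≤ (|x| + 1) ^ n := pow_le_pow_left₀ (abs_nonneg x) (by linarith) n
    _ = Real.exp R * (1 / 2 : ℝ) ^ n * ((2 * (|x| + 1)) ^ n * Real.exp (-R)) := by
        have h2 : (1 / 2 : ℝ) ^ n * (2 * (|x| + 1)) ^ n = (|x| + 1) ^ n := by
          rw [← mul_pow]; congr 1; ring
        have h3 : Real.exp R * Real.exp (-R) = 1 := by
          rw [← Real.exp_add, add_neg_cancel, Real.exp_zero]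
        calc (|x| + 1) ^ n
            = (Real.exp R * Real.exp (-R)) * ((1 / 2 : ℝ) ^ n * (2 * (|x| + 1)) ^ n) := by
              rw [h2, h3, one_mul]
          _ = _ := by ring
    _ ≤ Real.exp R * (1 / 2 : ℝ) ^ n * Real.Gamma (1 + α * n) :=
        mul_le_mul_of_nonneg_left hG (by positivity)

/-- `f` is completely monotone on `(0, ∞)`: it is smooth there and its successive derivatives
alternate in sign, starting with a nonnegative one. -/
def IsCompletelyMonotone (f : ℝ → ℝ) : Prop :=
  ContDiffOn ℝ ∞ f (Ioi 0) ∧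
    ∀ (n : ℕ) (x : ℝ), 0 < x → 0 ≤ (-1) ^ n * iteratedDeriv n f x

/-- `μ` is a Bernstein measure of `f`: a positive σ-finite measure carried by `[0, ∞)` whose
Laplace transform is finite and equal to `f` on `(0, ∞)`. -/
structure IsBernsteinMeasure (f : ℝ → ℝ) (μ : Measure ℝ) : Prop where
  sigmaFinite : SigmaFinite μ
  nonneg : μ (Iio 0) = 0
  integrable : ∀ x : ℝ, 0 < x → Integrable (fun t => Real.exp (-(x * t))) μ
  laplace : ∀ x : ℝ, 0 < x → ∫ t, Real.exp (-(x * t)) ∂μ = f x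

/-- `ν` is the law of the standard positive `β`-stable variable `Z_β`: a probability measure
carried by `(0, ∞)` with Laplace transform `E[exp (-l Z_β)] = exp (-l ^ β)` for `l ≥ 0`. -/
structure IsPositiveStableLaw (β : ℝ) (ν : Measure ℝ) : Prop where
  isProbabilityMeasure : IsProbabilityMeasure ν
  pos : ν (Iic 0) = 0
  laplace : ∀ l : ℝ, 0 ≤ l → ∫ z, Real.exp (-(l * z)) ∂ν = Real.exp (-(l ^ β))

/-!
Write `γ = 1 - α`. Both halves of the identity for `f_α` are expressed through one even kernel
`K_γ(x) = sin (πγ) / (2π (cosh x + cos (πγ)))`: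

* `e ^ s / α - E_α(s ^ α) = ∫ K_γ(α x) exp (-s e ^ x) dx` (`integral_stableKernel_one_sub`);
* `𝔼[exp (-(s / Z_γ) ^ γ)] = ∫ K_γ(γ x) exp (-s e ^ x) dx`
  (`IsPositiveStableLaw.integral_exp_neg_div_rpow`).

Given the second one, the Laplace transform of `W = (Z₁ / Z₂) ^ γ` at `x` is obtained by integrating
out `Z₂` and then `Z₁`: since `Z₁` has index `γ / α`, the result is
`∫ K_γ(γ y) exp (-x ^ (1 / α) e ^ (γ y / α)) dy`, and the linear substitution `y ↦ α y / γ` turns it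
into the integral of the first formula at `s = x ^ (1 / α)`
(`integral_exp_neg_mul_div_rpow`).

Each of the two formulas is proved by comparing Laplace transforms in `s`. On the left these are
elementary: a geometric series for `E_α`, and the derivative of `exp (-l ^ γ)` for the stable
variable. On the right one finds Stieltjes transforms `∫ K_γ(a x) / (e ^ x + p) dx`, which are
evaluated by Cauchy's theorem. In the logarithmic coordinate `z = log q` the slit plane becomes the
strip `|Im z| < π`, the kernel is the jump across this strip of `e ^ (γ z) / (e ^ (γ z) + 1)`,
respectively of `e ^ z / (α (e ^ z - 1)) - e ^ (α z) / (e ^ (α z) - 1)`, and the integral over long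
rectangles gives the value of the function at `log p` (`integral_jump_div`).

Uniqueness of the Bernstein measure is the uniqueness theorem for Laplace transforms
(`ext_of_laplace`), obtained by exponential tilting from the identity theorem for the complex
moment-generating function. Complete monotonicity for `α ≥ 1 / 2` is differentiation under the
integral sign. For `α < 1 / 2` we have `1 / α > 2`, so near `0` the quadratic term
`-x ^ 2 / Γ(1 + 2α)` dominates the exponential and `f_α` is not convex
(`half_le_of_isCompletelyMonotone`).

Positive stable laws of index `β < 1` are constructed as limits: the same kernel shows that
`1 / (1 + l ^ β)` is the Laplace transform of a mixture of exponential laws, hence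
`(1 + l ^ β / n) ^ (-n)` is one of a probability measure, and compactness of the space of probability
measures on `[0, 1]`, in the variable `e ^ (-t)`, gives `exp (-l ^ β)` in the limit
(`exists_isPositiveStableLaw`).
-/

/-! ### Cauchy's formula in a strip -/

theorem exp_add_pi_mul_I (x : ℝ) : Complex.exp (x + Real.pi * Complex.I) = -Real.exp x := by
  rw [Complex.exp_add, Complex.exp_pi_mul_I]; simp

theorem exp_sub_pi_mul_I (x : ℝ) :
    Complex.exp (x + (-Real.pi : ℝ) * Complex.I) = -Real.exp x := by
  rw [Complex.exp_add]
  have : Complex.exp ((-Real.pi : ℝ) * Complex.I) = -1 := by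
    rw [Complex.ofReal_neg, neg_mul, Complex.exp_neg, Complex.exp_pi_mul_I]; norm_num
  rw [this]; simp

theorem exp_ne_exp_of_abs_im_lt {z : ℂ} {y : ℝ} (hz : |z.im| < 2 * Real.pi) (hzy : z ≠ y) :
    Complex.exp z ≠ Complex.exp y := by
  intro h
  obtain ⟨n, hn⟩ := Complex.exp_eq_exp_iff_exists_int.1 h
  have him : z.im = n * (2 * Real.pi) := by
    rw [hn]; simp
  have hn0 : n = 0 := by
    by_contra hne
    have h1 : (1 : ℝ) ≤ |(n : ℝ)| := by
      rw [← Int.cast_abs]; exact_mod_cast Int.one_le_abs hne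
    rw [him, abs_mul, abs_of_pos Real.two_pi_pos] at hz
    nlinarith [Real.two_pi_pos]
  apply hzy
  rw [hn, hn0]; simp

/-- In the strip `|Im z| < 2π` the only zero of `exp z - exp y` is `y`, and it is simple. -/
theorem dslope_exp_ne_zero {z : ℂ} {y : ℝ} (hz : |z.im| < 2 * Real.pi) :
    dslope Complex.exp y z ≠ 0 := by
  by_cases hzy : z = y
  · subst hzy
    rw [dslope_same, Complex.deriv_exp]
    exact Complex.exp_ne_zero _
  · rw [dslope_of_ne _ hzy, slope_def_field]
    exact div_ne_zero (sub_ne_zero.2 (exp_ne_exp_of_abs_im_lt hz hzy)) (sub_ne_zero.2 hzy)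

theorem isOpen_abs_im_lt (b : ℝ) : IsOpen {z : ℂ | |z.im| < b} :=
  isOpen_lt (by fun_prop) continuous_const

theorem differentiableOn_dslope_div_dslope_exp {φ : ℂ → ℂ} {b : ℝ} (hb0 : 0 < b)
    (hb : b ≤ 2 * Real.pi) (hφ : DifferentiableOn ℂ φ {z | |z.im| < b}) (y : ℝ) :
    DifferentiableOn ℂ (fun z => dslope φ y z / dslope Complex.exp y z) {z | |z.im| < b} := by
  have hmem : {z : ℂ | |z.im| < b} ∈ nhds (y : ℂ) :=
    (isOpen_abs_im_lt b).mem_nhds (by simpa using hb0)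
  refine DifferentiableOn.div ((Complex.differentiableOn_dslope hmem).2 hφ)
    ((Complex.differentiableOn_dslope hmem).2 Complex.differentiable_exp.differentiableOn)
    fun z hz => dslope_exp_ne_zero (lt_of_lt_of_le hz hb)

theorem dslope_div_dslope_exp {φ : ℂ → ℂ} {z : ℂ} {y : ℝ} (hzy : z ≠ y) :
    dslope φ y z / dslope Complex.exp y z
      = (φ z - φ y) / (Complex.exp z - Complex.exp y) := by
  rw [dslope_of_ne _ hzy, dslope_of_ne _ hzy, slope_def_field, slope_def_field,
    div_div_div_cancel_right₀ (sub_ne_zero.2 hzy)]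

/-- **Cauchy's formula on the slit plane** in logarithmic coordinates. A function `φ` that is
analytic near the strip `|Im z| ≤ π`, decays exponentially on the left and is bounded on the right
is recovered from its jump `2πi J` across the strip. -/
theorem integral_jump_div {φ : ℂ → ℂ} {J : ℝ → ℝ} {a b C : ℝ} (ha : 0 < a) (hbπ : Real.pi < b)
    (hb : b ≤ 2 * Real.pi) (hφ : DifferentiableOn ℂ φ {z | |z.im| < b})
    (hleft : ∀ z : ℂ, |z.im| ≤ Real.pi → z.re ≤ -1 → ‖φ z‖ ≤ C * Real.exp (a * z.re))
    (hright : ∀ z : ℂ, |z.im| ≤ Real.pi → 1 ≤ z.re → ‖φ z‖ ≤ C)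
    (hJ : ∀ x : ℝ, φ (x + Real.pi * Complex.I) - φ (x + (-Real.pi : ℝ) * Complex.I)
      = 2 * Real.pi * Complex.I * J x)
    (hJi : Integrable J) (y : ℝ) :
    ((∫ x, J x / (Real.exp x + Real.exp y) : ℝ) : ℂ) = φ y / Real.exp y := by
  have hπ := Real.pi_pos
  set g : ℂ → ℂ := fun z => dslope φ y z / dslope Complex.exp y z with hg
  have hgd : DifferentiableOn ℂ g {z | |z.im| < b} :=
    differentiableOn_dslope_div_dslope_exp (hπ.trans hbπ) hb hφ y
  -- the integrand along the horizontal sides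
  have hI : Integrable fun x => J x / (Real.exp x + Real.exp y) := by
    simp_rw [div_eq_mul_inv]
    refine hJi.mul_bdd (c := (Real.exp y)⁻¹) ?_ ?_
    · refine (Continuous.inv₀ (by fun_prop) fun x => ?_).aestronglyMeasurable
      positivity
    · refine Filter.Eventually.of_forall fun x => ?_
      rw [Real.norm_of_nonneg (by positivity)]
      gcongr
      linarith [Real.exp_pos x]
  have hlim : Filter.Tendsto
      (fun R : ℝ => ∫ x in (-R)..R, J x / (Real.exp x + Real.exp y)) Filter.atTop
      (nhds (∫ x, J x / (Real.exp x + Real.exp y))) :=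
    intervalIntegral_tendsto_integral hI Filter.tendsto_neg_atTop_atBot Filter.tendsto_id
  have hhor : ∀ R : ℝ, (∫ x in (-R)..R, g (x + (-Real.pi : ℝ) * Complex.I))
      - (∫ x in (-R)..R, g (x + Real.pi * Complex.I))
      = 2 * Real.pi * Complex.I * ((∫ x in (-R)..R, J x / (Real.exp x + Real.exp y) : ℝ) : ℂ) := by
    intro R
    have hc : ∀ t : ℝ, |t| ≤ Real.pi → Continuous fun x : ℝ => g (x + t * Complex.I) := by
      intro t ht
      refine ContinuousOn.comp_continuous hgd.continuousOn (by fun_prop) fun x => ?_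
      simpa using ht.trans_lt hbπ
    rw [← intervalIntegral.integral_sub
      ((hc _ (by rw [abs_neg, abs_of_pos hπ])).intervalIntegrable _ _)
      ((hc _ (by rw [abs_of_pos hπ])).intervalIntegrable _ _), ← intervalIntegral.integral_ofReal,
      ← intervalIntegral.integral_const_mul]
    refine intervalIntegral.integral_congr fun x _ => ?_
    have h1 : (x : ℂ) + (-Real.pi : ℝ) * Complex.I ≠ y := by
      intro h
      have := congrArg Complex.im h
      simp at this
    have h2 : (x : ℂ) + Real.pi * Complex.I ≠ y := by
      intro h
      have := congrArg Complex.im h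
      simp at this
    simp only [hg]
    rw [dslope_div_dslope_exp h1, dslope_div_dslope_exp h2, exp_sub_pi_mul_I, exp_add_pi_mul_I]
    have hne : ((Real.exp x : ℝ) : ℂ) + Real.exp y ≠ 0 := by
      rw [← Complex.ofReal_add]
      exact_mod_cast (by positivity : Real.exp x + Real.exp y ≠ 0)
    have hne' : -((Real.exp x : ℝ) : ℂ) - Real.exp y ≠ 0 := by
      rw [← neg_add']; exact neg_ne_zero.2 hne
    rw [← Complex.ofReal_exp, Complex.ofReal_div, Complex.ofReal_add, ← mul_div_assoc, ← hJ x,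
      ← sub_div, div_eq_div_iff hne' hne]
    ring
  -- the right side tends to zero
  have hR : Filter.Tendsto
      (fun R : ℝ => ∫ t in (-Real.pi)..Real.pi, g (R + t * Complex.I)) Filter.atTop (nhds 0) := by
    have hb' : ∀ᶠ R : ℝ in Filter.atTop,
        ‖∫ t in (-Real.pi)..Real.pi, g (R + t * Complex.I)‖
          ≤ (C + ‖φ y‖) / (Real.exp R - Real.exp y) * |Real.pi - -Real.pi| := by
      filter_upwards [Filter.eventually_ge_atTop (|y| + 1)] with R hR
      have hRy : y < R := by linarith [le_abs_self y]
      have hden : 0 < Real.exp R - Real.exp y := sub_pos.2 (Real.exp_lt_exp.2 hRy)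
      refine intervalIntegral.norm_integral_le_of_norm_le_const fun t ht => ?_
      rw [uIoc_of_le (by linarith)] at ht
      have ht' : |t| ≤ Real.pi := abs_le.2 ⟨ht.1.le, ht.2⟩
      have hne : (R : ℂ) + t * Complex.I ≠ y := by
        intro h
        have := congrArg Complex.re h
        simp at this
        linarith
      simp only [hg]
      rw [dslope_div_dslope_exp hne, norm_div]
      have hC := hright (R + t * Complex.I) (by simpa using ht')
        (by simp; linarith [abs_nonneg y])
      have hd : Real.exp R - Real.exp y
          ≤ ‖Complex.exp (R + t * Complex.I) - Complex.exp y‖ := by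
        refine le_trans ?_ (norm_sub_norm_le _ _)
        rw [Complex.norm_exp, Complex.norm_exp]; simp
      have hC0 : 0 ≤ C := (norm_nonneg _).trans hC
      exact div_le_div₀ (by positivity) ((norm_sub_le _ _).trans (by linarith)) hden hd
    refine squeeze_zero_norm' hb' ?_
    rw [← zero_mul |Real.pi - -Real.pi|]
    refine Filter.Tendsto.mul_const _ (Filter.Tendsto.const_div_atTop ?_ _)
    exact Filter.tendsto_atTop_add_const_right _ _ Real.tendsto_exp_atTop
  -- the left side carries the value at `y`
  have hL : Filter.Tendsto
      (fun R : ℝ => ∫ t in (-Real.pi)..Real.pi, g ((-R : ℝ) + t * Complex.I)) Filter.atTop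
      (nhds (2 * Real.pi * (φ y / Real.exp y))) := by
    have hb' : ∀ᶠ R : ℝ in Filter.atTop,
        ‖(∫ t in (-Real.pi)..Real.pi, g ((-R : ℝ) + t * Complex.I))
          - 2 * Real.pi * (φ y / Real.exp y)‖
          ≤ (C * Real.exp (a * -R) * Real.exp y + ‖φ y‖ * Real.exp (-R))
            / (Real.exp y * (Real.exp y - Real.exp (-R))) * |Real.pi - -Real.pi| := by
      filter_upwards [Filter.eventually_ge_atTop (|y| + 1)] with R hR
      have hRy : -R < y := by linarith [neg_abs_le y]
      have hden : 0 < Real.exp y - Real.exp (-R) := sub_pos.2 (Real.exp_lt_exp.2 hRy)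
      have hci : IntervalIntegrable (fun t : ℝ => g ((-R : ℝ) + t * Complex.I)) volume
          (-Real.pi) Real.pi := by
        refine ContinuousOn.intervalIntegrable ?_
        refine hgd.continuousOn.comp (by fun_prop) fun t ht => ?_
        rw [uIcc_of_le (by linarith)] at ht
        have : |t| < b := (abs_le.2 ⟨ht.1, ht.2⟩).trans_lt hbπ
        simpa using this
      have hconst : (2 * Real.pi * (φ y / Real.exp y) : ℂ)
          = ∫ _t in (-Real.pi)..Real.pi, (φ y / Real.exp y : ℂ) := by
        rw [intervalIntegral.integral_const, sub_neg_eq_add, ← two_mul, Complex.real_smul]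
        push_cast; ring
      rw [hconst, ← intervalIntegral.integral_sub hci intervalIntegrable_const]
      refine intervalIntegral.norm_integral_le_of_norm_le_const fun t ht => ?_
      rw [uIoc_of_le (by linarith)] at ht
      have ht' : |t| ≤ Real.pi := abs_le.2 ⟨ht.1.le, ht.2⟩
      set z : ℂ := (-R : ℝ) + t * Complex.I with hz
      have hzre : z.re = -R := by simp [hz]
      have hne : z ≠ y := by
        intro h
        have := congrArg Complex.re h
        rw [hzre, Complex.ofReal_re] at this
        linarith
      have hC := hleft z (by simpa [hz] using ht') (by rw [hzre]; linarith [abs_nonneg y])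
      rw [hzre] at hC
      have hd : Real.exp y - Real.exp (-R) ≤ ‖Complex.exp z - Complex.exp y‖ := by
        rw [norm_sub_rev]
        refine le_trans ?_ (norm_sub_norm_le _ _)
        rw [Complex.norm_exp, Complex.norm_exp, hzre, Complex.ofReal_re]
      have hne0 : Complex.exp z - Complex.exp y ≠ 0 := norm_pos_iff.1 (hden.trans_le hd)
      have hey : Complex.exp y ≠ 0 := Complex.exp_ne_zero _
      simp only [hg]
      rw [dslope_div_dslope_exp hne, Complex.ofReal_exp]
      have hsub : (φ z - φ y) / (Complex.exp z - Complex.exp y) - φ y / Complex.exp y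
          = (φ z * Complex.exp y - φ y * Complex.exp z)
            / (Complex.exp y * (Complex.exp z - Complex.exp y)) := by
        field_simp
        ring
      rw [hsub, norm_div, norm_mul (Complex.exp y), Complex.norm_exp (y : ℂ), Complex.ofReal_re]
      have hC0 : 0 ≤ C * Real.exp (a * -R) := (norm_nonneg _).trans hC
      refine div_le_div₀ (by positivity) ((norm_sub_le _ _).trans ?_) (by positivity) (by gcongr)
      rw [norm_mul, norm_mul, Complex.norm_exp, Complex.norm_exp, hzre, Complex.ofReal_re]
      gcongr
    rw [tendsto_iff_norm_sub_tendsto_zero]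
    refine squeeze_zero' (Filter.Eventually.of_forall fun _ => norm_nonneg _) hb' ?_
    have hn : Filter.Tendsto (fun R : ℝ => Real.exp (-R)) Filter.atTop (nhds 0) :=
      Real.tendsto_exp_neg_atTop_nhds_zero
    have hn' : Filter.Tendsto (fun R : ℝ => Real.exp (a * -R)) Filter.atTop (nhds 0) := by
      refine Real.tendsto_exp_atBot.comp ?_
      exact Filter.Tendsto.const_mul_atBot ha Filter.tendsto_neg_atTop_atBot
    have hnum := (((hn'.const_mul C).mul_const (Real.exp y)).add (hn.const_mul ‖φ y‖))
    have hdn := (hn.const_sub (Real.exp y)).const_mul (Real.exp y)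
    have := (hnum.div hdn (by simp [(Real.exp_pos y).ne'])).mul_const |Real.pi - -Real.pi|
    simpa using this
  -- Cauchy's theorem on the rectangle
  have hrect : ∀ R : ℝ, 2 * Real.pi * Complex.I
      * ((∫ x in (-R)..R, J x / (Real.exp x + Real.exp y) : ℝ) : ℂ)
      + Complex.I * (∫ t in (-Real.pi)..Real.pi, g (R + t * Complex.I))
      - Complex.I * (∫ t in (-Real.pi)..Real.pi, g ((-R : ℝ) + t * Complex.I)) = 0 := by
    intro R
    have h := Complex.integral_boundary_rect_eq_zero_of_differentiableOn g
      ⟨-R, -Real.pi⟩ ⟨R, Real.pi⟩ (hgd.mono fun z hz => ?_)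
    · simp only [smul_eq_mul] at h
      rw [← hhor R]
      exact h
    · have h2 : z.im ∈ uIcc (-Real.pi) Real.pi := hz.2
      rw [uIcc_of_le (by linarith)] at h2
      exact (abs_le.2 ⟨h2.1, h2.2⟩).trans_lt hbπ
  have hlimc := ((Complex.continuous_ofReal.tendsto _).comp hlim).const_mul
    (2 * Real.pi * Complex.I)
  have htot := (hlimc.add (hR.const_mul Complex.I)).sub (hL.const_mul Complex.I)
  have h0 := tendsto_nhds_unique (htot.congr fun R => hrect R) tendsto_const_nhds
  have hpi : (2 * Real.pi * Complex.I : ℂ) ≠ 0 := Complex.two_pi_I_ne_zero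
  apply mul_left_cancel₀ hpi
  linear_combination h0

/-! ### The stable kernel and its Stieltjes transforms -/

/-- The even kernel `sin (πγ) / (2π (cosh x + cos (πγ)))`. The function `x ↦ stableKernel γ (γ * x)`
is the density of the logarithm of the quotient of two independent positive `γ`-stable variables;
working with the logarithm turns the slit plane into a strip. -/
noncomputable def stableKernel (γ x : ℝ) : ℝ :=
  Real.sin (Real.pi * γ) / (2 * Real.pi * (Real.cosh x + Real.cos (Real.pi * γ)))

theorem one_add_sq_div_four_le_cosh (x : ℝ) : 1 + x ^ 2 / 4 ≤ Real.cosh x := by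
  rw [← Real.cosh_abs, ← sq_abs, Real.cosh_eq]
  have h1 := Real.quadratic_le_exp_of_nonneg (abs_nonneg x)
  have h2 := Real.add_one_le_exp (-|x|)
  linarith

theorem one_add_cos_pi_mul_pos {γ : ℝ} (hγ : γ ∈ Ioo (0 : ℝ) 1) :
    0 < 1 + Real.cos (Real.pi * γ) := by
  have h : 0 < Real.cos (Real.pi * γ / 2) := by
    apply Real.cos_pos_of_mem_Ioo
    constructor <;> nlinarith [Real.pi_pos, hγ.1, hγ.2]
  have h2 : Real.cos (Real.pi * γ) = 2 * Real.cos (Real.pi * γ / 2) ^ 2 - 1 := by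
    rw [← Real.cos_two_mul]; congr 1; ring
  rw [h2]; nlinarith

theorem sin_pi_mul_pos {γ : ℝ} (hγ : γ ∈ Ioo (0 : ℝ) 1) : 0 < Real.sin (Real.pi * γ) :=
  Real.sin_pos_of_pos_of_lt_pi (mul_pos Real.pi_pos hγ.1)
    (by nlinarith [Real.pi_pos, hγ.2])

theorem cosh_add_cos_pos {γ : ℝ} (hγ : γ ∈ Ioo (0 : ℝ) 1) (x : ℝ) :
    0 < Real.cosh x + Real.cos (Real.pi * γ) := by
  linarith [one_add_cos_pi_mul_pos hγ, Real.one_le_cosh x]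

theorem stableKernel_pos {γ : ℝ} (hγ : γ ∈ Ioo (0 : ℝ) 1) (x : ℝ) : 0 < stableKernel γ x :=
  div_pos (sin_pi_mul_pos hγ) (mul_pos Real.two_pi_pos (cosh_add_cos_pos hγ x))

theorem continuous_stableKernel {γ : ℝ} (hγ : γ ∈ Ioo (0 : ℝ) 1) :
    Continuous (stableKernel γ) := by
  unfold stableKernel
  refine Continuous.div continuous_const ?_ fun x =>
    (mul_pos Real.two_pi_pos (cosh_add_cos_pos hγ x)).ne'
  have := Real.continuous_cosh
  fun_prop

theorem integrable_stableKernel {γ : ℝ} (hγ : γ ∈ Ioo (0 : ℝ) 1) :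
    Integrable (stableKernel γ) := by
  set m := min (1 + Real.cos (Real.pi * γ)) (1 / 4) with hm
  have hm0 : 0 < m := lt_min (one_add_cos_pi_mul_pos hγ) (by norm_num)
  refine ((integrable_inv_one_add_sq).const_mul
    (Real.sin (Real.pi * γ) / (2 * Real.pi * m))).mono'
    (continuous_stableKernel hγ).aestronglyMeasurable (Filter.Eventually.of_forall fun x => ?_)
  rw [Real.norm_of_nonneg (stableKernel_pos hγ x).le, ← div_eq_mul_inv, div_div]
  have h1 : m * (1 + x ^ 2) ≤ Real.cosh x + Real.cos (Real.pi * γ) := by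
    have h2 := one_add_sq_div_four_le_cosh x
    have h3 : m ≤ 1 + Real.cos (Real.pi * γ) := min_le_left _ _
    have h4 : m ≤ 1 / 4 := min_le_right _ _
    nlinarith [sq_nonneg x]
  have hs := (sin_pi_mul_pos hγ).le
  have hpi := Real.pi_pos
  rw [mul_assoc (2 * Real.pi)]
  unfold stableKernel
  gcongr

theorem integrable_stableKernel_mul {γ a : ℝ} (hγ : γ ∈ Ioo (0 : ℝ) 1) (ha : a ≠ 0) :
    Integrable fun x => stableKernel γ (a * x) :=
  (integrable_stableKernel hγ).comp_mul_left' ha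

theorem norm_div_add_le {w s : ℂ} {ρ : ℝ} (hs : ‖s‖ = 1) (hρ : ρ < 1) (hw : ‖w‖ ≤ ρ) :
    ‖w / (w + s)‖ ≤ (1 - ρ)⁻¹ * ‖w‖ := by
  have h : 1 - ρ ≤ ‖w + s‖ := by
    have := norm_sub_norm_le s (-w)
    rw [sub_neg_eq_add, norm_neg, add_comm s w, hs] at this
    linarith
  have h0 : 0 < 1 - ρ := by linarith
  rw [norm_div, div_eq_mul_inv, mul_comm]
  gcongr

theorem norm_div_add_le' {w s : ℂ} {ρ : ℝ} (hs : ‖s‖ = 1) (hρ : ρ < 1) (hw : 1 ≤ ρ * ‖w‖) :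
    ‖w / (w + s)‖ ≤ (1 - ρ)⁻¹ := by
  have h0 : 0 < 1 - ρ := by linarith
  have hw0 : 0 < ‖w‖ := by
    rcases (norm_nonneg w).eq_or_lt with h | h
    · rw [← h] at hw; norm_num at hw
    · exact h
  have h : (1 - ρ) * ‖w‖ ≤ ‖w + s‖ := by
    have := norm_sub_norm_le w (-s)
    rw [sub_neg_eq_add, norm_neg, hs] at this
    linarith
  rw [norm_div, div_le_iff₀ ((mul_pos h0 hw0).trans_le h)]
  calc ‖w‖ = (1 - ρ)⁻¹ * ((1 - ρ) * ‖w‖) := by field_simp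
    _ ≤ _ := by gcongr

theorem norm_exp_mul_div_le_of_re_le {a : ℝ} (ha : 0 < a) {s : ℂ} (hs : ‖s‖ = 1) {z : ℂ}
    (hz : z.re ≤ -1) :
    ‖Complex.exp (a * z) / (Complex.exp (a * z) + s)‖
      ≤ (1 - Real.exp (-a))⁻¹ * Real.exp (a * z.re) := by
  have hn : ‖Complex.exp (a * z)‖ = Real.exp (a * z.re) := by
    rw [Complex.norm_exp]; simp
  rw [← hn]
  refine norm_div_add_le hs (by simpa using ha) ?_
  rw [hn]
  apply Real.exp_le_exp.2
  nlinarith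

theorem norm_exp_mul_div_le_of_le_re {a : ℝ} (ha : 0 < a) {s : ℂ} (hs : ‖s‖ = 1) {z : ℂ}
    (hz : 1 ≤ z.re) :
    ‖Complex.exp (a * z) / (Complex.exp (a * z) + s)‖ ≤ (1 - Real.exp (-a))⁻¹ := by
  have hn : ‖Complex.exp (a * z)‖ = Real.exp (a * z.re) := by
    rw [Complex.norm_exp]; simp
  refine norm_div_add_le' hs (by simpa using ha) ?_
  rw [hn, ← Real.exp_add]
  apply Real.one_le_exp
  nlinarith

theorem exp_pi_mul_I_mul (a x s : ℝ) :
    Complex.exp (a * (x + (s * Real.pi : ℝ) * Complex.I))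
      = Real.exp (a * x) * (Real.cos (s * (Real.pi * a)) + Real.sin (s * (Real.pi * a)) *
        Complex.I) := by
  rw [mul_add, Complex.exp_add, Complex.ofReal_cos, Complex.ofReal_sin, ← Complex.exp_mul_I]
  push_cast
  congr 2
  ring

/-- The jump of `e ^ (az) / (e ^ (az) + s)`, `s = ±1`, across the strip `|Im z| ≤ π`. -/
theorem exp_mul_div_jump {a s : ℝ} (hs : s ^ 2 = 1) (x : ℝ)
    (hpos : 0 < Real.cosh (a * x) + s * Real.cos (Real.pi * a)) :
    Complex.exp (a * (x + Real.pi * Complex.I))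
        / (Complex.exp (a * (x + Real.pi * Complex.I)) + s)
      - Complex.exp (a * (x + (-Real.pi : ℝ) * Complex.I))
        / (Complex.exp (a * (x + (-Real.pi : ℝ) * Complex.I)) + s)
      = 2 * Real.pi * Complex.I * (s * (Real.sin (Real.pi * a)
        / (2 * Real.pi * (Real.cosh (a * x) + s * Real.cos (Real.pi * a)))) : ℝ) := by
  have e1 := exp_pi_mul_I_mul a x 1
  have e2 := exp_pi_mul_I_mul a x (-1)
  rw [one_mul, one_mul] at e1
  rw [neg_one_mul, neg_one_mul, Real.cos_neg, Real.sin_neg] at e2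
  rw [e1, e2]
  set w := Real.exp (a * x) with hw
  have hw0 : 0 < w := Real.exp_pos _
  have hcosh : Real.cosh (a * x) = (w + w⁻¹) / 2 := by
    rw [Real.cosh_eq, Real.exp_neg]
  rw [hcosh] at hpos ⊢
  set c := Real.cos (Real.pi * a)
  set d := Real.sin (Real.pi * a)
  have hcd : d ^ 2 + c ^ 2 = 1 := Real.sin_sq_add_cos_sq _
  have hq : 0 < w ^ 2 + 2 * s * c * w + 1 := by
    have : w ^ 2 + 2 * s * c * w + 1 = 2 * w * ((w + w⁻¹) / 2 + s * c) := by
      field_simp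
      ring
    rw [this]; positivity
  have hprod : ((w : ℂ) * (c + d * Complex.I) + s) * ((w : ℂ) * (c + (-d : ℝ) * Complex.I) + s)
      = ((w ^ 2 + 2 * s * c * w + 1 : ℝ) : ℂ) := by
    have h1 : (d : ℂ) ^ 2 + (c : ℂ) ^ 2 = 1 := by exact_mod_cast hcd
    have h2 : (s : ℂ) ^ 2 = 1 := by exact_mod_cast hs
    push_cast
    linear_combination (w : ℂ) ^ 2 * h1 + h2 - (w : ℂ) ^ 2 * (d : ℂ) ^ 2 * Complex.I_sq
  have hne : ((w ^ 2 + 2 * s * c * w + 1 : ℝ) : ℂ) ≠ 0 := by exact_mod_cast hq.ne'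
  have hne1 := left_ne_zero_of_mul (hprod ▸ hne)
  have hne2 := right_ne_zero_of_mul (hprod ▸ hne)
  rw [div_sub_div _ _ hne1 hne2, hprod]
  have hr : s * (d / (2 * Real.pi * ((w + w⁻¹) / 2 + s * c)))
      = s * d * w / (Real.pi * (w ^ 2 + 2 * s * c * w + 1)) := by
    have : (w + w⁻¹) / 2 + s * c = (w ^ 2 + 2 * s * c * w + 1) / (2 * w) := by
      field_simp
      ring
    rw [this]
    field_simp
  rw [hr, Complex.ofReal_div, Complex.ofReal_mul Real.pi]
  have hpi : (Real.pi : ℂ) ≠ 0 := by exact_mod_cast Real.pi_ne_zero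
  rw [mul_div_assoc', div_eq_div_iff hne (mul_ne_zero hpi hne)]
  push_cast
  ring

theorem differentiableOn_exp_mul_div {a b : ℝ} {s : ℂ}
    (h : ∀ z : ℂ, |z.im| < b → Complex.exp (a * z) + s ≠ 0) :
    DifferentiableOn ℂ (fun z => Complex.exp (a * z) / (Complex.exp (a * z) + s))
      {z | |z.im| < b} := by
  refine DifferentiableOn.div (by fun_prop) (by fun_prop) fun z hz => h z hz

theorem rpow_eq_exp_mul_log {q : ℝ} (hq : 0 < q) (a : ℝ) :
    Real.exp (a * Real.log q) = q ^ a := by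
  rw [Real.rpow_def_of_pos hq, mul_comm]

/-- Stieltjes transform of the quotient of two independent positive `γ`-stable variables. -/
theorem integral_stableKernel_div {γ q : ℝ} (hγ : γ ∈ Ioo (0 : ℝ) 1) (hq : 0 < q) :
    ∫ x, stableKernel γ (γ * x) / (Real.exp x + q) = q ^ (γ - 1) / (q ^ γ + 1) := by
  have hπ := Real.pi_pos
  have hγ0 := hγ.1
  set b := min (2 * Real.pi) (Real.pi / γ) with hb
  have hbπ : Real.pi < b := by
    refine lt_min (by linarith) ?_
    rw [lt_div_iff₀ hγ.1]
    nlinarith [hγ.2]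
  have hne : ∀ z : ℂ, |z.im| < b → Complex.exp (γ * z) + (1 : ℝ) ≠ 0 := by
    intro z hz h
    have him : |γ * z.im| < Real.pi := by
      rw [abs_mul, abs_of_pos hγ0, mul_comm, ← lt_div_iff₀ hγ0]
      exact hz.trans_le (min_le_right _ _)
    have h1 : Complex.exp (γ * z) = -1 := by
      rw [Complex.ofReal_one] at h
      exact eq_neg_of_add_eq_zero_left h
    rw [← Complex.exp_pi_mul_I] at h1
    obtain ⟨n, hn⟩ := Complex.exp_eq_exp_iff_exists_int.1 h1
    have h2 := congrArg Complex.im hn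
    simp at h2
    have h3 : γ * z.im = Real.pi * (1 + 2 * n : ℤ) := by push_cast; linarith
    rw [h3, abs_mul, abs_of_pos hπ, ← Int.cast_abs] at him
    have h4 : (1 : ℝ) ≤ ((|1 + 2 * n| : ℤ) : ℝ) := by
      exact_mod_cast Int.one_le_abs (by omega)
    nlinarith
  have key := integral_jump_div (φ := fun z => Complex.exp (γ * z) / (Complex.exp (γ * z) + (1 : ℝ)))
    (J := fun x => stableKernel γ (γ * x)) (C := (1 - Real.exp (-γ))⁻¹) hγ0 hbπ (min_le_left _ _)
    (differentiableOn_exp_mul_div hne)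
    (fun z _ hz => norm_exp_mul_div_le_of_re_le hγ0 (by simp) hz)
    (fun z _ hz => norm_exp_mul_div_le_of_le_re hγ0 (by simp) hz)
    (fun x => ?_) (integrable_stableKernel_mul hγ hγ0.ne') (Real.log q)
  · rw [Real.exp_log hq] at key
    have h1 : Complex.exp (γ * (Real.log q : ℝ)) = ((q ^ γ : ℝ) : ℂ) := by
      rw [← rpow_eq_exp_mul_log hq]; push_cast; rfl
    simp only [h1] at key
    have key' : ∫ x, stableKernel γ (γ * x) / (Real.exp x + q) = q ^ γ / (q ^ γ + 1) / q := by
      exact_mod_cast key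
    rw [key', Real.rpow_sub_one hq.ne']
    ring
  · have := exp_mul_div_jump (a := γ) (s := 1) (by norm_num) x
      (by rw [one_mul]; exact cosh_add_cos_pos hγ _)
    rw [one_mul, one_mul] at this
    exact this

theorem dslope_exp_zero_ne_zero {z : ℂ} (hz : |z.im| < 2 * Real.pi) :
    dslope Complex.exp 0 z ≠ 0 := by
  simpa using dslope_exp_ne_zero (y := 0) hz

/-- Stieltjes transform of the density whose Laplace transform, in the variable `x ^ (1 / α)`, is
`f_α`. The pole of `p ^ (α - 1) / (p ^ α - 1)` at `p = 1` is cancelled by `1 / (α (p - 1))`. -/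
theorem integral_stableKernel_one_sub_div {α p : ℝ} (hα : α ∈ Ioo (0 : ℝ) 1) (hp : 1 < p) :
    ∫ x, stableKernel (1 - α) (α * x) / (Real.exp x + p)
      = 1 / (α * (p - 1)) - p ^ (α - 1) / (p ^ α - 1) := by
  have hπ := Real.pi_pos
  have hα0 := hα.1
  have hp0 : 0 < p := by linarith
  have hγ : 1 - α ∈ Ioo (0 : ℝ) 1 := ⟨by linarith [hα.2], by linarith⟩
  have hαc : (α : ℂ) ≠ 0 := by exact_mod_cast hα0.ne'
  -- `k z / z` extends the combination of the two fractions analytically across `z = 0`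
  set E : ℂ → ℂ := dslope Complex.exp 0 with hE
  set k : ℂ → ℂ := fun z => (1 / α : ℂ) * (Complex.exp z / E z - Complex.exp (α * z) / E (α * z))
    with hk
  set φ : ℂ → ℂ := dslope k 0 with hφ
  have hEmul : ∀ z : ℂ, z * E z = Complex.exp z - 1 := by
    intro z
    have := sub_smul_dslope Complex.exp 0 z
    simpa using this
  have hk0 : k 0 = 0 := by simp [hk]
  have hstrip : ∀ z : ℂ, |z.im| < 2 * Real.pi → |(α * z).im| < 2 * Real.pi := by
    intro z hz
    have : (α * z).im = α * z.im := by simp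
    rw [this, abs_mul, abs_of_pos hα0]
    nlinarith [abs_nonneg z.im, hα.2]
  have hφeq : ∀ z : ℂ, |z.im| < 2 * Real.pi → z ≠ 0 →
      φ z = (1 / α : ℂ) * (Complex.exp ((1 : ℝ) * z) / (Complex.exp ((1 : ℝ) * z) + (-1 : ℝ)))
        - Complex.exp (α * z) / (Complex.exp (α * z) + (-1 : ℝ)) := by
    intro z hz hz0
    rw [hφ, dslope_of_ne _ hz0, slope_def_field, hk0, sub_zero, sub_zero]
    simp only [hk]
    have e1 : Complex.exp z + (-1 : ℝ) = z * E z := by rw [hEmul]; push_cast; ring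
    have e2 : Complex.exp (α * z) + (-1 : ℝ) = α * z * E (α * z) := by
      rw [hEmul]; push_cast; ring
    rw [Complex.ofReal_one, one_mul, e1, e2]
    have n1 : E z ≠ 0 := dslope_exp_zero_ne_zero hz
    have n2 : E (α * z) ≠ 0 := dslope_exp_zero_ne_zero (hstrip z hz)
    field_simp
  have hEd : Differentiable ℂ E := by
    have := (Complex.differentiableOn_dslope (f := Complex.exp) (s := univ) (c := 0)
      Filter.univ_mem).2 Complex.differentiable_exp.differentiableOn
    exact differentiableOn_univ.1 this
  have hkd : DifferentiableOn ℂ k {z | |z.im| < 2 * Real.pi} := by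
    refine DifferentiableOn.const_mul (DifferentiableOn.sub ?_ ?_) _
    · exact DifferentiableOn.div (by fun_prop) (by fun_prop) fun z hz => dslope_exp_zero_ne_zero hz
    · refine DifferentiableOn.div (by fun_prop)
        (Differentiable.comp hEd (by fun_prop)).differentiableOn
        fun z hz => dslope_exp_zero_ne_zero (hstrip z hz)
  have hφd : DifferentiableOn ℂ φ {z | |z.im| < 2 * Real.pi} := by
    refine (Complex.differentiableOn_dslope ((isOpen_abs_im_lt _).mem_nhds ?_)).2 hkd
    simpa using hπ
  set C := (1 / α) * (1 - Real.exp (-1))⁻¹ + (1 - Real.exp (-α))⁻¹ with hC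
  have hc1 : 0 < (1 - Real.exp (-1))⁻¹ := inv_pos.2 (by simp)
  have hnorm : ‖(1 / α : ℂ)‖ = 1 / α := by
    rw [norm_div, norm_one, Complex.norm_real, Real.norm_of_nonneg hα0.le]
  have key := integral_jump_div (φ := φ)
    (J := fun x => stableKernel (1 - α) (α * x)) (C := C) hα0 (by linarith) le_rfl hφd ?_ ?_
    (fun x => ?_) (integrable_stableKernel_mul hγ hα0.ne') (Real.log p)
  · rw [Real.exp_log hp0, hφeq _ (by simpa using hπ)
      (by exact_mod_cast (Real.log_pos hp).ne')] at key
    have h1 : ∀ a : ℝ, Complex.exp (a * (Real.log p : ℝ)) = ((p ^ a : ℝ) : ℂ) := by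
      intro a
      rw [← rpow_eq_exp_mul_log hp0]; push_cast; rfl
    rw [h1, h1, Real.rpow_one] at key
    have key' : ∫ x, stableKernel (1 - α) (α * x) / (Real.exp x + p)
        = (1 / α * (p / (p + -1)) - p ^ α / (p ^ α + -1)) / p := by
      exact_mod_cast key
    rw [key', Real.rpow_sub_one hp0.ne', ← sub_eq_add_neg, ← sub_eq_add_neg, sub_div]
    congr 1
    · field_simp
    · ring
  · intro z hz hre
    rw [hφeq z (by linarith) (by rintro rfl; norm_num at hre)]
    refine (norm_sub_le _ _).trans ?_
    rw [norm_mul, hnorm, hC, add_mul, mul_assoc]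
    have b1 := norm_exp_mul_div_le_of_re_le one_pos (s := ((-1 : ℝ) : ℂ)) (by simp) hre
    have b2 := norm_exp_mul_div_le_of_re_le hα0 (s := ((-1 : ℝ) : ℂ)) (by simp) hre
    have b3 : Real.exp (1 * z.re) ≤ Real.exp (α * z.re) := by
      apply Real.exp_le_exp.2
      nlinarith [hα.2]
    refine add_le_add (mul_le_mul_of_nonneg_left (b1.trans ?_) (by positivity)) b2
    exact mul_le_mul_of_nonneg_left b3 hc1.le
  · intro z hz hre
    rw [hφeq z (by linarith) (by rintro rfl; norm_num at hre)]
    refine (norm_sub_le _ _).trans ?_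
    rw [norm_mul, hnorm, hC]
    have b1 := norm_exp_mul_div_le_of_le_re one_pos (s := ((-1 : ℝ) : ℂ)) (by simp) hre
    have b2 := norm_exp_mul_div_le_of_le_re hα0 (s := ((-1 : ℝ) : ℂ)) (by simp) hre
    exact add_le_add (mul_le_mul_of_nonneg_left b1 (by positivity)) b2
  · have hz0 : ∀ s : ℝ, s ≠ 0 → (x : ℂ) + (s : ℝ) * Complex.I ≠ 0 := by
      intro s hs h
      have := congrArg Complex.im h
      simp at this
      exact hs this
    rw [hφeq _ (by simp [abs_of_pos hπ]; linarith) (hz0 _ hπ.ne'),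
      hφeq _ (by simp [abs_of_pos hπ]; linarith) (hz0 _ (neg_ne_zero.2 hπ.ne'))]
    have hcos : Real.cos (Real.pi * (1 - α)) = -Real.cos (Real.pi * α) := by
      rw [mul_sub, mul_one, Real.cos_pi_sub]
    have hsin : Real.sin (Real.pi * (1 - α)) = Real.sin (Real.pi * α) := by
      rw [mul_sub, mul_one, Real.sin_pi_sub]
    have hj := exp_mul_div_jump (a := α) (s := -1) (by norm_num) x
      (by have := cosh_add_cos_pos hγ (α * x); rw [hcos] at this; linarith)
    have hK : (-1 : ℝ) * (Real.sin (Real.pi * α)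
        / (2 * Real.pi * (Real.cosh (α * x) + -1 * Real.cos (Real.pi * α))))
        = -stableKernel (1 - α) (α * x) := by
      rw [stableKernel, hcos, hsin]; ring
    rw [hK] at hj
    simp only [Complex.ofReal_one, one_mul]
    rw [exp_add_pi_mul_I, exp_sub_pi_mul_I]
    rw [Complex.ofReal_neg (stableKernel _ _)] at hj
    linear_combination -hj

/-! ### Uniqueness of Laplace transforms -/

/-- Finite measures whose moment-generating functions are finite and equal on `(-∞, 1)` coincide. -/
theorem ext_of_mgf_eq_of_lt_one {μ ν : Measure ℝ} [IsFiniteMeasure μ] [IsFiniteMeasure ν]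
    (hμ : ∀ y < 1, Integrable (fun t => Real.exp (y * t)) μ)
    (hν : ∀ y < 1, Integrable (fun t => Real.exp (y * t)) ν)
    (h : ∀ y < 1, mgf id μ y = mgf id ν y) : μ = ν := by
  have hsub : ∀ {ρ : Measure ℝ}, (∀ y < 1, Integrable (fun t => Real.exp (y * t)) ρ) →
      Iio 1 ⊆ interior (integrableExpSet id ρ) := fun hρ =>
    interior_maximal (fun y hy => hρ y hy) isOpen_Iio
  have han : ∀ {ρ : Measure ℝ}, (∀ y < 1, Integrable (fun t => Real.exp (y * t)) ρ) →
      AnalyticOnNhd ℂ (complexMGF id ρ) {z | z.re ∈ Iio (1 : ℝ)} := fun hρ =>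
    analyticOnNhd_complexMGF.mono fun z hz => hsub hρ hz
  have heq : EqOn (complexMGF id μ) (complexMGF id ν) {z | z.re ∈ Iio (1 : ℝ)} := by
    refine AnalyticOnNhd.eqOn_of_preconnected_of_frequently_eq (han hμ) (han hν)
      ((convex_Iio (1 : ℝ)).linear_preimage Complex.reLm).isPreconnected
      (z₀ := ((0 : ℝ) : ℂ)) (by simp) ?_
    have hreal : ∃ᶠ x : ℝ in nhdsWithin 0 {0}ᶜ, complexMGF id μ x = complexMGF id ν x := by
      refine Filter.Eventually.frequently ?_
      filter_upwards [mem_nhdsWithin_of_mem_nhds (Iio_mem_nhds (zero_lt_one' ℝ))] with x hx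
      rw [complexMGF_ofReal, complexMGF_ofReal, h x hx]
    have ht : Filter.Tendsto ((↑) : ℝ → ℂ) (nhdsWithin 0 {0}ᶜ)
        (nhdsWithin ((0 : ℝ) : ℂ) {((0 : ℝ) : ℂ)}ᶜ) := by
      refine tendsto_nhdsWithin_iff.2
        ⟨(Complex.continuous_ofReal.tendsto 0).mono_left nhdsWithin_le_nhds, ?_⟩
      filter_upwards [self_mem_nhdsWithin] with x hx
      simpa using hx
    exact ht.frequently hreal
  refine Measure.ext_of_charFun (funext fun t => ?_)
  rw [← complexMGF_id_mul_I, ← complexMGF_id_mul_I]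
  exact heq (by simp)

/-- **Uniqueness of the Laplace transform**: it suffices that the transforms are finite and equal
on a half-line. -/
theorem ext_of_laplace {μ ν : Measure ℝ} {c : ℝ}
    (hμ : ∀ p, c < p → ∫⁻ t, ENNReal.ofReal (Real.exp (-(p * t))) ∂μ ≠ ⊤)
    (h : ∀ p, c < p → ∫⁻ t, ENNReal.ofReal (Real.exp (-(p * t))) ∂μ
      = ∫⁻ t, ENNReal.ofReal (Real.exp (-(p * t))) ∂ν) : μ = ν := by
  set w : ℝ → ENNReal := fun t => ENNReal.ofReal (Real.exp (-((c + 1) * t))) with hw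
  have hwm : Measurable w := by fun_prop
  have hw0 : ∀ t, w t ≠ 0 := fun t => by simp [hw, Real.exp_pos]
  have hwt : ∀ t, w t ≠ ⊤ := fun t => ENNReal.ofReal_ne_top
  have hlin : ∀ (ρ : Measure ℝ) (y : ℝ),
      ∫⁻ t, ENNReal.ofReal (Real.exp (y * t)) ∂(ρ.withDensity w)
        = ∫⁻ t, ENNReal.ofReal (Real.exp (-((c + 1 - y) * t))) ∂ρ := by
    intro ρ y
    rw [lintegral_withDensity_eq_lintegral_mul _ hwm (by fun_prop)]
    refine lintegral_congr fun t => ?_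
    simp only [Pi.mul_apply, hw]
    rw [← ENNReal.ofReal_mul (Real.exp_pos _).le, ← Real.exp_add]
    congr 2; ring
  have hν : ∀ p, c < p → ∫⁻ t, ENNReal.ofReal (Real.exp (-(p * t))) ∂ν ≠ ⊤ := fun p hp =>
    h p hp ▸ hμ p hp
  have hint : ∀ {ρ : Measure ℝ},
      (∀ p, c < p → ∫⁻ t, ENNReal.ofReal (Real.exp (-(p * t))) ∂ρ ≠ ⊤) →
      ∀ y < 1, Integrable (fun t => Real.exp (y * t)) (ρ.withDensity w) := by
    intro ρ hρ y hy
    refine ⟨by fun_prop, ?_⟩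
    rw [hasFiniteIntegral_iff_ofReal (Filter.Eventually.of_forall fun t => (Real.exp_pos _).le),
      hlin]
    exact (hρ _ (by linarith)).lt_top
  have hfin : ∀ {ρ : Measure ℝ},
      (∀ p, c < p → ∫⁻ t, ENNReal.ofReal (Real.exp (-(p * t))) ∂ρ ≠ ⊤) →
      IsFiniteMeasure (ρ.withDensity w) := fun hρ =>
    isFiniteMeasure_withDensity (hρ (c + 1) (by linarith))
  have := hfin hμ
  have := hfin hν
  have key : μ.withDensity w = ν.withDensity w := by
    refine ext_of_mgf_eq_of_lt_one (hint hμ) (hint hν) fun y hy => ?_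
    simp only [mgf, id]
    rw [integral_eq_lintegral_of_nonneg_ae (Filter.Eventually.of_forall fun t => (Real.exp_pos _).le)
      (by fun_prop), integral_eq_lintegral_of_nonneg_ae
      (Filter.Eventually.of_forall fun t => (Real.exp_pos _).le) (by fun_prop), hlin, hlin,
      h _ (by linarith)]
  rw [← withDensity_inv_same (μ := μ) hwm (Filter.Eventually.of_forall hw0)
    (Filter.Eventually.of_forall hwt), key, withDensity_inv_same hwm (Filter.Eventually.of_forall hw0)
    (Filter.Eventually.of_forall hwt)]

/-- Nonnegative continuous functions on `(0, ∞)` with the same finite Laplace transform on a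
half-line are equal. -/
theorem eqOn_of_laplace {u v : ℝ → ℝ} {c : ℝ} {F : ℝ → ℝ}
    (hu : ContinuousOn u (Ioi 0)) (hv : ContinuousOn v (Ioi 0))
    (hu0 : ∀ s, 0 < s → 0 ≤ u s) (hv0 : ∀ s, 0 < s → 0 ≤ v s)
    (hFu : ∀ p, c < p →
      ∫⁻ s in Ioi 0, ENNReal.ofReal (Real.exp (-(p * s)) * u s) = ENNReal.ofReal (F p))
    (hFv : ∀ p, c < p →
      ∫⁻ s in Ioi 0, ENNReal.ofReal (Real.exp (-(p * s)) * v s) = ENNReal.ofReal (F p)) :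
    EqOn u v (Ioi 0) := by
  have hm : ∀ {g : ℝ → ℝ}, ContinuousOn g (Ioi 0) →
      AEMeasurable (fun s => ENNReal.ofReal (g s)) (volume.restrict (Ioi 0)) := fun hg =>
    (hg.aemeasurable measurableSet_Ioi).ennreal_ofReal
  have hlin : ∀ {g : ℝ → ℝ}, ContinuousOn g (Ioi 0) → ∀ p,
      ∫⁻ t, ENNReal.ofReal (Real.exp (-(p * t)))
        ∂((volume.restrict (Ioi 0)).withDensity fun s => ENNReal.ofReal (g s))
      = ∫⁻ s in Ioi 0, ENNReal.ofReal (Real.exp (-(p * s)) * g s) := by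
    intro g hg p
    rw [lintegral_withDensity_eq_lintegral_mul₀ (hm hg) (by fun_prop)]
    refine lintegral_congr fun t => ?_
    rw [Pi.mul_apply, ENNReal.ofReal_mul (Real.exp_pos _).le, mul_comm]
  have heq : (volume.restrict (Ioi (0 : ℝ))).withDensity (fun s => ENNReal.ofReal (u s))
      = (volume.restrict (Ioi 0)).withDensity fun s => ENNReal.ofReal (v s) := by
    refine ext_of_laplace (c := c) (fun p hp => ?_) fun p hp => ?_
    · rw [hlin hu, hFu p hp]; exact ENNReal.ofReal_ne_top
    · rw [hlin hu, hlin hv, hFu p hp, hFv p hp]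
  have hae := (withDensity_eq_iff_of_sigmaFinite (hm hu) (hm hv)).1 heq
  have hae' : u =ᵐ[volume.restrict (Ioi 0)] v := by
    filter_upwards [hae, self_mem_ae_restrict measurableSet_Ioi] with s hs hs0
    exact (ENNReal.ofReal_eq_ofReal_iff (hu0 s hs0) (hv0 s hs0)).1 hs
  refine Measure.eqOn_open_of_ae_eq hae' isOpen_Ioi hu hv

/-! ### Laplace transforms of the kernel and of inverse stable variables -/

theorem lintegral_Ioi_mul_exp_neg_mul {b k : ℝ} (hb : 0 < b) (hk : 0 ≤ k) :
    ∫⁻ s in Ioi 0, ENNReal.ofReal (k * Real.exp (-(b * s))) = ENNReal.ofReal (k / b) := by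
  have hint : IntegrableOn (fun s => Real.exp (-b * s)) (Ioi 0) :=
    integrableOn_exp_mul_Ioi (by linarith) 0
  have hval := integral_exp_mul_Ioi (a := -b) (by linarith) 0
  simp_rw [← neg_mul]
  rw [← ofReal_integral_eq_lintegral_ofReal (hint.const_mul k)
    (Filter.Eventually.of_forall fun s => mul_nonneg hk (Real.exp_pos _).le), integral_const_mul,
    hval]
  simp [div_eq_mul_inv]

theorem integrable_div_exp_add {k : ℝ → ℝ} (hk : Integrable k) {p : ℝ} (hp : 0 < p) :
    Integrable fun x => k x / (Real.exp x + p) := by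
  simp_rw [div_eq_mul_inv]
  refine hk.mul_bdd (c := p⁻¹) ?_ ?_
  · refine (Continuous.inv₀ (by fun_prop) fun x => ?_).aestronglyMeasurable
    positivity
  · refine Filter.Eventually.of_forall fun x => ?_
    rw [Real.norm_of_nonneg (by positivity)]
    gcongr
    linarith [Real.exp_pos x]

theorem integrable_mul_exp_neg_mul_exp {k : ℝ → ℝ} (hk : Integrable k) {s : ℝ} (hs : 0 ≤ s) :
    Integrable fun x => k x * Real.exp (-(s * Real.exp x)) := by
  refine hk.mul_bdd (c := 1) (by fun_prop) (Filter.Eventually.of_forall fun x => ?_)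
  rw [Real.norm_of_nonneg (Real.exp_pos _).le]
  apply Real.exp_le_one_iff.2
  have := Real.exp_pos x
  nlinarith

theorem continuousOn_integral_mul_exp_neg {k : ℝ → ℝ} (hk : Integrable k) :
    ContinuousOn (fun s : ℝ => ∫ x, k x * Real.exp (-(s * Real.exp x))) (Ioi 0) := by
  refine continuousOn_of_dominated (bound := fun x => ‖k x‖)
    (fun s hs => (integrable_mul_exp_neg_mul_exp hk (le_of_lt hs)).aestronglyMeasurable)
    (fun s hs => Filter.Eventually.of_forall fun x => ?_) hk.norm
    (Filter.Eventually.of_forall fun x => by fun_prop)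
  rw [norm_mul, Real.norm_of_nonneg (Real.exp_pos _).le]
  have hs' : (0 : ℝ) < s := hs
  refine mul_le_of_le_one_right (norm_nonneg _) (Real.exp_le_one_iff.2 ?_)
  have := Real.exp_pos x
  nlinarith

/-- The Laplace transform of a Laplace transform is a Stieltjes transform. -/
theorem lintegral_laplace_laplace {k : ℝ → ℝ} (hk : Integrable k) (hk0 : ∀ x, 0 ≤ k x) {p : ℝ}
    (hp : 0 < p) :
    ∫⁻ s in Ioi 0, ENNReal.ofReal
        (Real.exp (-(p * s)) * ∫ x, k x * Real.exp (-(s * Real.exp x)))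
      = ENNReal.ofReal (∫ x, k x / (Real.exp x + p)) := by
  have h1 : ∀ s ∈ Ioi (0 : ℝ), ENNReal.ofReal
      (Real.exp (-(p * s)) * ∫ x, k x * Real.exp (-(s * Real.exp x)))
      = ∫⁻ x, ENNReal.ofReal (k x * Real.exp (-((Real.exp x + p) * s))) := by
    intro s hs
    rw [← integral_const_mul, ofReal_integral_eq_lintegral_ofReal
      ((integrable_mul_exp_neg_mul_exp hk (le_of_lt hs)).const_mul _)
      (Filter.Eventually.of_forall fun x =>
        mul_nonneg (Real.exp_pos _).le (mul_nonneg (hk0 x) (Real.exp_pos _).le))]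
    refine lintegral_congr fun x => ?_
    rw [mul_left_comm, ← Real.exp_add]
    congr 3; ring
  rw [setLIntegral_congr_fun measurableSet_Ioi h1, lintegral_lintegral_swap,
    ofReal_integral_eq_lintegral_ofReal (integrable_div_exp_add hk hp)
      (Filter.Eventually.of_forall fun x => div_nonneg (hk0 x) (by positivity))]
  · refine lintegral_congr fun x => ?_
    exact lintegral_Ioi_mul_exp_neg_mul (by positivity) (hk0 x)
  · have hkm : AEMeasurable (fun q : ℝ × ℝ => k q.2) ((volume.restrict (Ioi 0)).prod volume) :=
      hk.aemeasurable.comp_snd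
    exact (hkm.mul (by fun_prop)).ennreal_ofReal

theorem lintegral_Ioi_comp_mul {z : ℝ} (hz : 0 < z) (g : ℝ → ENNReal) :
    ∫⁻ s in Ioi 0, g s = ∫⁻ u in Ioi 0, ENNReal.ofReal z * g (z * u) := by
  have himg : (fun u => z * u) '' Ioi (0 : ℝ) = Ioi 0 := by
    rw [image_mul_left_Ioi hz, mul_zero]
  have := lintegral_image_eq_lintegral_abs_deriv_mul (f := fun u => z * u) (f' := fun _ => z)
    (measurableSet_Ioi (a := (0 : ℝ)))
    (fun u _ => by simpa using ((hasDerivAt_id u).const_mul z).hasDerivWithinAt)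
    (fun a _ b _ hab => mul_left_cancel₀ hz.ne' hab) g
  rw [himg, abs_of_pos hz] at this
  exact this

namespace IsPositiveStableLaw

variable {β : ℝ} {ν : Measure ℝ}

theorem ae_pos (h : IsPositiveStableLaw β ν) : ∀ᵐ z ∂ν, 0 < z := by
  rw [ae_iff]
  simp only [not_lt]
  exact h.pos

theorem integrable_exp_mul (h : IsPositiveStableLaw β ν) {t : ℝ} (ht : t ≤ 0) :
    Integrable (fun z => Real.exp (t * z)) ν := by
  have := h.isProbabilityMeasure
  refine Integrable.mono' (integrable_const (1 : ℝ)) (by fun_prop) ?_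
  filter_upwards [h.ae_pos] with z hz
  rw [Real.norm_of_nonneg (Real.exp_pos _).le]
  exact Real.exp_le_one_iff.2 (mul_nonpos_of_nonpos_of_nonneg ht hz.le)

theorem mem_interior (h : IsPositiveStableLaw β ν) {t : ℝ} (ht : t < 0) :
    t ∈ interior (integrableExpSet id ν) :=
  interior_maximal (fun _ hs => h.integrable_exp_mul (le_of_lt hs)) isOpen_Iio ht

/-- Differentiation of the Laplace transform. -/
theorem lintegral_mul_exp (h : IsPositiveStableLaw β ν) {l : ℝ} (hl : 0 < l) :
    ∫⁻ z, ENNReal.ofReal (z * Real.exp (-(l * z))) ∂ν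
      = ENNReal.ofReal (β * l ^ (β - 1) * Real.exp (-(l ^ β))) := by
  have hmem := h.mem_interior (neg_lt_zero.2 hl)
  have hd := deriv_mgf hmem
  have heq : mgf id ν =ᶠ[nhds (-l)] fun t => Real.exp (-((-t) ^ β)) := by
    filter_upwards [Iio_mem_nhds (neg_lt_zero.2 hl)] with t ht
    rw [← h.laplace (-t) (by linarith [mem_Iio.1 ht])]
    simp [mgf]
  have hder : HasDerivAt (fun t : ℝ => Real.exp (-((-t) ^ β)))
      (β * l ^ (β - 1) * Real.exp (-(l ^ β))) (-l) := by
    have h1 : HasDerivAt (fun t : ℝ => -t) (-1) (-l) := hasDerivAt_neg _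
    have h2 := ((h1.rpow_const (p := β) (by left; simpa using hl.ne')).neg).exp
    convert h2 using 1
    · rfl
    · simp only [Pi.neg_apply, neg_neg]
      ring
  rw [heq.deriv_eq, hder.deriv] at hd
  rw [hd, ofReal_integral_eq_lintegral_ofReal]
  · simp [neg_mul]
  · simpa using integrable_pow_mul_exp_of_mem_interior_integrableExpSet hmem 1
  · filter_upwards [h.ae_pos] with z hz
    exact mul_nonneg hz.le (Real.exp_pos _).le

theorem integrable_exp_neg_div_rpow (h : IsPositiveStableLaw β ν) {s : ℝ} (hs : 0 < s) :
    Integrable (fun z => Real.exp (-((s / z) ^ β))) ν := by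
  have := h.isProbabilityMeasure
  refine Integrable.mono' (integrable_const (1 : ℝ))
    (by fun_prop : Measurable _).aestronglyMeasurable ?_
  filter_upwards [h.ae_pos] with z hz
  rw [Real.norm_of_nonneg (Real.exp_pos _).le]
  exact Real.exp_le_one_iff.2 (neg_nonpos.2 (by positivity))

theorem continuousOn_integral_exp_neg_div_rpow (h : IsPositiveStableLaw β ν) :
    ContinuousOn (fun s : ℝ => ∫ z, Real.exp (-((s / z) ^ β)) ∂ν) (Ioi 0) := by
  have := h.isProbabilityMeasure
  refine continuousOn_of_dominated (bound := fun _ => 1)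
    (fun s _ => (by fun_prop : Measurable _).aestronglyMeasurable) (fun s hs => ?_)
    (integrable_const _) ?_
  · filter_upwards [h.ae_pos] with z hz
    have hs' : (0 : ℝ) < s := hs
    rw [Real.norm_of_nonneg (Real.exp_pos _).le]
    exact Real.exp_le_one_iff.2 (neg_nonpos.2 (by positivity))
  · filter_upwards [h.ae_pos] with z hz
    intro s hs
    have hs' : (0 : ℝ) < s / z := div_pos hs hz
    have : ContinuousAt (fun s : ℝ => (s / z) ^ β) s :=
      ContinuousAt.rpow_const (by fun_prop) (Or.inl hs'.ne')
    exact (Real.continuous_exp.continuousAt.comp this.neg).continuousWithinAt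

/-- The Laplace transform in `s` of `𝔼[exp (-(s / Z) ^ β)]`: after the substitution `s = Z u` it is
an integral of the derivative of the Laplace transform of `Z`. -/
theorem lintegral_laplace_exp_neg_div_rpow (h : IsPositiveStableLaw β ν) (hβ : 0 < β) {q : ℝ}
    (hq : 0 < q) :
    ∫⁻ s in Ioi 0, ENNReal.ofReal
        (Real.exp (-(q * s)) * ∫ z, Real.exp (-((s / z) ^ β)) ∂ν)
      = ENNReal.ofReal (q ^ (β - 1) / (q ^ β + 1)) := by
  have := h.isProbabilityMeasure
  have h1 : ∀ s ∈ Ioi (0 : ℝ), ENNReal.ofReal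
      (Real.exp (-(q * s)) * ∫ z, Real.exp (-((s / z) ^ β)) ∂ν)
      = ∫⁻ z, ENNReal.ofReal (Real.exp (-(q * s)) * Real.exp (-((s / z) ^ β))) ∂ν := by
    intro s hs
    rw [← integral_const_mul, ofReal_integral_eq_lintegral_ofReal
      ((h.integrable_exp_neg_div_rpow hs).const_mul _)
      (Filter.Eventually.of_forall fun x => by positivity)]
  have h2 : ∀ᵐ z ∂ν,
      ∫⁻ s in Ioi 0, ENNReal.ofReal (Real.exp (-(q * s)) * Real.exp (-((s / z) ^ β)))
        = ∫⁻ u in Ioi 0, ENNReal.ofReal (Real.exp (-(u ^ β)))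
          * ENNReal.ofReal (z * Real.exp (-((q * u) * z))) := by
    filter_upwards [h.ae_pos] with z hz
    rw [lintegral_Ioi_comp_mul hz]
    refine lintegral_congr fun u => ?_
    rw [← ENNReal.ofReal_mul hz.le, ← ENNReal.ofReal_mul (Real.exp_pos _).le,
      mul_div_cancel_left₀ _ hz.ne']
    congr 1
    rw [show q * (z * u) = q * u * z by ring]
    ring
  have h3 : ∀ u ∈ Ioi (0 : ℝ), ∫⁻ z, ENNReal.ofReal (Real.exp (-(u ^ β)))
        * ENNReal.ofReal (z * Real.exp (-((q * u) * z))) ∂ν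
      = ENNReal.ofReal (β * q ^ (β - 1) * (u ^ (β - 1) * Real.exp (-(q ^ β + 1) * u ^ β))) := by
    intro u hu
    have hu' : (0 : ℝ) < u := hu
    rw [lintegral_const_mul _ (by fun_prop), h.lintegral_mul_exp (mul_pos hq hu'),
      ← ENNReal.ofReal_mul (Real.exp_pos _).le]
    congr 1
    rw [Real.mul_rpow hq.le hu'.le, Real.mul_rpow hq.le hu'.le, show -(q ^ β + 1) * u ^ β
      = -(u ^ β) + -(q ^ β * u ^ β) by ring, Real.exp_add]
    ring
  have hqβ : 0 < q ^ β + 1 := by positivity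
  have hval := integral_rpow_mul_exp_neg_mul_rpow (p := β) (q := β - 1) (b := q ^ β + 1) hβ
    (by linarith) hqβ
  have hint := integrableOn_rpow_mul_exp_neg_mul_rpow (p := β) (s := β - 1) (b := q ^ β + 1)
    (by linarith) hβ hqβ
  rw [setLIntegral_congr_fun measurableSet_Ioi h1, lintegral_lintegral_swap
    (by fun_prop), lintegral_congr_ae h2, lintegral_lintegral_swap (by fun_prop),
    setLIntegral_congr_fun measurableSet_Ioi h3, ← ofReal_integral_eq_lintegral_ofReal
      (hint.const_mul _), integral_const_mul, hval]
  · congr 1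
    rw [sub_add_cancel, neg_div, div_self hβ.ne', Real.Gamma_one, Real.rpow_neg_one]
    field_simp
  · filter_upwards [self_mem_ae_restrict measurableSet_Ioi] with u hu
    have hu' : (0 : ℝ) < u := hu
    positivity

/-- For a positive `γ`-stable variable `Z`, the function `𝔼[exp (-(s / Z) ^ γ)]` is the Laplace
transform of an explicit density, that of the quotient of two independent copies of `Z`. -/
theorem integral_exp_neg_div_rpow {γ : ℝ} (h : IsPositiveStableLaw γ ν) (hγ : γ ∈ Ioo (0 : ℝ) 1)
    {s : ℝ} (hs : 0 < s) :
    ∫ z, Real.exp (-((s / z) ^ γ)) ∂ν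
      = ∫ x, stableKernel γ (γ * x) * Real.exp (-(s * Real.exp x)) := by
  have hk := integrable_stableKernel_mul hγ hγ.1.ne'
  have hk0 : ∀ x, 0 ≤ stableKernel γ (γ * x) := fun x => (stableKernel_pos hγ _).le
  refine eqOn_of_laplace (c := 0) (F := fun q => q ^ (γ - 1) / (q ^ γ + 1))
    h.continuousOn_integral_exp_neg_div_rpow (continuousOn_integral_mul_exp_neg hk)
    (fun s _ => integral_nonneg fun z => (Real.exp_pos _).le)
    (fun s _ => integral_nonneg fun x => mul_nonneg (hk0 x) (Real.exp_pos _).le)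
    (fun q hq => h.lintegral_laplace_exp_neg_div_rpow hγ.1 hq) (fun q hq => ?_) hs
  rw [lintegral_laplace_laplace hk hk0 hq, integral_stableKernel_div hγ hq]

end IsPositiveStableLaw

/-! ### The Mittag-Leffler function -/

theorem continuous_mittagLeffler {α : ℝ} (hα : 0 < α) : Continuous (mittagLeffler α) := by
  rw [continuous_iff_continuousAt]
  intro x
  have hon : ContinuousOn (mittagLeffler α) (Metric.ball 0 (|x| + 1)) := by
    refine continuousOn_tsum (fun n => by fun_prop) (summable_mittagLeffler hα (|x| + 1))
      fun n y hy => ?_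
    have hG : 0 < Real.Gamma (1 + α * n) := Real.Gamma_pos_of_pos (by positivity)
    rw [mem_ball_zero_iff, Real.norm_eq_abs] at hy
    rw [norm_div, norm_pow, Real.norm_of_nonneg hG.le, Real.norm_eq_abs]
    gcongr
  exact hon.continuousAt (Metric.isOpen_ball.mem_nhds (by simp))

theorem mittagLeffler_nonneg {α x : ℝ} (hα : 0 < α) (hx : 0 ≤ x) : 0 ≤ mittagLeffler α x :=
  tsum_nonneg fun n => div_nonneg (pow_nonneg hx n)
    (Real.Gamma_pos_of_pos (by positivity)).le

theorem lintegral_rpow_mul_exp_neg {a p : ℝ} (ha : 0 < a) (hp : 0 < p) :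
    ∫⁻ s in Ioi 0, ENNReal.ofReal (s ^ (a - 1) * Real.exp (-(p * s)))
      = ENNReal.ofReal ((1 / p) ^ a * Real.Gamma a) := by
  have hval := Real.integral_rpow_mul_exp_neg_mul_Ioi ha hp
  have hG := Real.Gamma_pos_of_pos ha
  have hint : IntegrableOn (fun s : ℝ => s ^ (a - 1) * Real.exp (-(p * s))) (Ioi 0) :=
    .of_integral_ne_zero (by rw [hval]; positivity)
  rw [← hval, ofReal_integral_eq_lintegral_ofReal hint]
  filter_upwards [self_mem_ae_restrict measurableSet_Ioi] with s hs
  have hs' : (0 : ℝ) < s := hs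
  positivity

/-- Termwise integration of the Mittag-Leffler series gives a geometric series. -/
theorem lintegral_laplace_mittagLeffler {α p : ℝ} (hα : 0 < α) (hp : 1 < p) :
    ∫⁻ s in Ioi 0, ENNReal.ofReal (Real.exp (-(p * s)) * mittagLeffler α (s ^ α))
      = ENNReal.ofReal (p ^ (α - 1) / (p ^ α - 1)) := by
  have hp0 : 0 < p := by linarith
  have hG : ∀ n : ℕ, 0 < Real.Gamma (1 + α * n) := fun n =>
    Real.Gamma_pos_of_pos (by positivity)
  have h1 : ∀ s ∈ Ioi (0 : ℝ),
      ENNReal.ofReal (Real.exp (-(p * s)) * mittagLeffler α (s ^ α))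
        = ∑' n : ℕ, ENNReal.ofReal (Real.Gamma (1 + α * n))⁻¹
          * ENNReal.ofReal (s ^ (1 + α * n - 1) * Real.exp (-(p * s))) := by
    intro s hs
    have hs' : (0 : ℝ) < s := hs
    rw [mittagLeffler, ← tsum_mul_left, ENNReal.ofReal_tsum_of_nonneg]
    · refine tsum_congr fun n => ?_
      rw [← ENNReal.ofReal_mul (inv_nonneg.2 (hG n).le)]
      congr 1
      rw [add_sub_cancel_left, Real.rpow_mul hs'.le, Real.rpow_natCast]
      ring
    · intro n
      have := hG n
      positivity
    · exact (summable_mittagLeffler hα _).mul_left _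
  have hr0 : 0 ≤ (1 / p) ^ α := by positivity
  have hr1 : (1 / p) ^ α < 1 := by
    refine Real.rpow_lt_one (by positivity) ?_ hα
    rw [div_lt_one hp0]; exact hp
  have h2 : ∀ n : ℕ, ∫⁻ s in Ioi 0, ENNReal.ofReal (Real.Gamma (1 + α * n))⁻¹
          * ENNReal.ofReal (s ^ (1 + α * n - 1) * Real.exp (-(p * s)))
        = ENNReal.ofReal (1 / p * ((1 / p) ^ α) ^ n) := by
    intro n
    have hGn := hG n
    have hpos : 0 < 1 + α * n := by positivity
    rw [lintegral_const_mul _ (by fun_prop), lintegral_rpow_mul_exp_neg hpos hp0,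
      ← ENNReal.ofReal_mul (inv_nonneg.2 hGn.le)]
    congr 1
    rw [Real.rpow_add (by positivity), Real.rpow_one, Real.rpow_mul (by positivity),
      Real.rpow_natCast]
    field_simp
  rw [setLIntegral_congr_fun measurableSet_Ioi h1, lintegral_tsum fun n => by fun_prop,
    tsum_congr h2, ← ENNReal.ofReal_tsum_of_nonneg (fun n => by positivity)
      ((summable_geometric_of_lt_one hr0 hr1).mul_left _), tsum_mul_left,
    tsum_geometric_of_lt_one hr0 hr1]
  congr 1
  have hpα : 1 < p ^ α := Real.one_lt_rpow hp hα
  have h3 : p ^ α - 1 ≠ 0 := by linarith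
  have h4 : p ^ α ≠ 0 := by linarith
  rw [Real.div_rpow zero_le_one hp0.le, Real.one_rpow, Real.rpow_sub_one hp0.ne']
  field_simp

/-! ### Integral representations of `f_α` and of the quotient law -/

/-- The integral representation of `e ^ s / α - E_α(s ^ α)`. -/
theorem integral_stableKernel_one_sub {α s : ℝ} (hα : α ∈ Ioo (0 : ℝ) 1) (hs : 0 < s) :
    ∫ x, stableKernel (1 - α) (α * x) * Real.exp (-(s * Real.exp x))
      = Real.exp s / α - mittagLeffler α (s ^ α) := by
  have hγ : 1 - α ∈ Ioo (0 : ℝ) 1 := ⟨by linarith [hα.2], by linarith [hα.1]⟩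
  have hα0 := hα.1
  have hk := integrable_stableKernel_mul hγ hα0.ne'
  have hk0 : ∀ x, 0 ≤ stableKernel (1 - α) (α * x) := fun x => (stableKernel_pos hγ _).le
  have hI0 : ∀ s, 0 ≤ ∫ x, stableKernel (1 - α) (α * x) * Real.exp (-(s * Real.exp x)) :=
    fun s => integral_nonneg fun x => mul_nonneg (hk0 x) (Real.exp_pos _).le
  have hMc : ContinuousOn (fun s : ℝ => mittagLeffler α (s ^ α)) (Ioi 0) :=
    ((continuous_mittagLeffler hα0).comp (Real.continuous_rpow_const hα0.le)).continuousOn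
  have heq := eqOn_of_laplace (c := 1) (F := fun p => 1 / (α * (p - 1)))
    (u := fun s => Real.exp s / α)
    (v := fun s => mittagLeffler α (s ^ α)
      + ∫ x, stableKernel (1 - α) (α * x) * Real.exp (-(s * Real.exp x)))
    (by fun_prop) (hMc.add (continuousOn_integral_mul_exp_neg hk))
    (fun s _ => by positivity)
    (fun s hs => add_nonneg (mittagLeffler_nonneg hα0 (by positivity)) (hI0 s))
    (fun p hp => ?_) (fun p hp => ?_) hs
  · simp only at heq
    linarith
  · have h1 : ∀ s : ℝ, Real.exp (-(p * s)) * (Real.exp s / α)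
        = 1 / α * Real.exp (-((p - 1) * s)) := by
      intro s
      rw [mul_div_assoc', ← Real.exp_add, show -(p * s) + s = -((p - 1) * s) by ring]
      ring
    simp_rw [h1]
    rw [lintegral_Ioi_mul_exp_neg_mul (by linarith) (by positivity), div_div]
  · have hp0 : 0 < p := by linarith
    have hpα : 1 < p ^ α := Real.one_lt_rpow hp hα0
    have h1 : ∀ s ∈ Ioi (0 : ℝ), ENNReal.ofReal (Real.exp (-(p * s)) * (mittagLeffler α (s ^ α)
        + ∫ x, stableKernel (1 - α) (α * x) * Real.exp (-(s * Real.exp x))))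
        = ENNReal.ofReal (Real.exp (-(p * s)) * mittagLeffler α (s ^ α))
          + ENNReal.ofReal (Real.exp (-(p * s))
            * ∫ x, stableKernel (1 - α) (α * x) * Real.exp (-(s * Real.exp x))) := by
      intro s hs
      have hs' : (0 : ℝ) < s := hs
      rw [mul_add, ENNReal.ofReal_add]
      · exact mul_nonneg (Real.exp_pos _).le (mittagLeffler_nonneg hα0 (by positivity))
      · exact mul_nonneg (Real.exp_pos _).le (hI0 s)
    rw [setLIntegral_congr_fun measurableSet_Ioi h1, lintegral_add_left',
      lintegral_laplace_mittagLeffler hα0 hp, lintegral_laplace_laplace hk hk0 hp0,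
      integral_stableKernel_one_sub_div hα hp, ← ENNReal.ofReal_add]
    · congr 1; ring
    · exact div_nonneg (by positivity) (by linarith)
    · rw [← integral_stableKernel_one_sub_div hα hp]
      exact integral_nonneg fun x => div_nonneg (hk0 x) (by positivity)
    · refine AEMeasurable.ennreal_ofReal ?_
      exact AEMeasurable.mul (by fun_prop) (hMc.aemeasurable measurableSet_Ioi)

/-- The Laplace transform of `(Z₁ / Z₂) ^ (1 - α)`: integrating out the denominator leaves a mixture
of exponentials in `Z₁`, to which the Laplace transform of `Z₁` applies. -/
theorem integral_exp_neg_mul_div_rpow {α x : ℝ} {ν₁ ν₂ : Measure ℝ} (hα : α ∈ Ioo (0 : ℝ) 1)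
    (h₁ : IsPositiveStableLaw ((1 - α) / α) ν₁) (h₂ : IsPositiveStableLaw (1 - α) ν₂)
    (hx : 0 < x) :
    ∫ z, ∫ z', Real.exp (-(x * (z / z') ^ (1 - α))) ∂ν₂ ∂ν₁
      = α / (1 - α) * (Real.exp (x ^ (1 / α)) / α - mittagLeffler α x) := by
  have hα0 := hα.1
  have hγ : 1 - α ∈ Ioo (0 : ℝ) 1 := ⟨by linarith [hα.2], by linarith⟩
  have hγ0 := hγ.1
  set γ := 1 - α with hγdef
  set δ := γ / α with hδ
  have hδ0 : 0 < δ := div_pos hγ0 hα0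
  have := h₁.isProbabilityMeasure
  have hk := integrable_stableKernel_mul hγ hγ0.ne'
  set y := x ^ (1 / γ) with hy
  have hy0 : 0 < y := by positivity
  have hyγ : y ^ γ = x := by
    rw [hy, ← Real.rpow_mul hx.le, one_div_mul_cancel hγ0.ne', Real.rpow_one]
  have hyδ : y ^ δ = x ^ (1 / α) := by
    rw [hy, ← Real.rpow_mul hx.le, hδ]
    congr 1
    field_simp
  have hin : ∀ᵐ z ∂ν₁, ∫ z', Real.exp (-(x * (z / z') ^ γ)) ∂ν₂
      = ∫ t, stableKernel γ (γ * t) * Real.exp (-(y * z * Real.exp t)) := by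
    filter_upwards [h₁.ae_pos] with z hz
    rw [← h₂.integral_exp_neg_div_rpow hγ (mul_pos hy0 hz)]
    refine integral_congr_ae ?_
    filter_upwards [h₂.ae_pos] with z' hz'
    rw [mul_div_assoc, Real.mul_rpow hy0.le (by positivity), hyγ]
  have hprod : Integrable (Function.uncurry fun z t : ℝ =>
      stableKernel γ (γ * t) * Real.exp (-(y * z * Real.exp t))) (ν₁.prod volume) := by
    refine (hk.comp_snd ν₁).mul_bdd (c := 1) (by fun_prop) ?_
    filter_upwards [Measure.quasiMeasurePreserving_fst.ae h₁.ae_pos] with q hq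
    rw [Real.norm_of_nonneg (Real.exp_pos _).le]
    exact Real.exp_le_one_iff.2 (neg_nonpos.2 (by positivity))
  have hout : ∀ t : ℝ, ∫ z, stableKernel γ (γ * t) * Real.exp (-(y * z * Real.exp t)) ∂ν₁
      = stableKernel γ (α * (δ * t)) * Real.exp (-(x ^ (1 / α) * Real.exp (δ * t))) := by
    intro t
    have hl := h₁.laplace (y * Real.exp t) (by positivity)
    simp_rw [show ∀ z, y * z * Real.exp t = y * Real.exp t * z from fun z => by ring]
    rw [integral_const_mul, hl, Real.mul_rpow hy0.le (Real.exp_pos _).le, hyδ, ← Real.exp_mul,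
      show α * (δ * t) = γ * t by rw [hδ]; field_simp, mul_comm t δ]
  rw [integral_congr_ae hin, integral_integral_swap hprod]
  simp_rw [hout]
  rw [Measure.integral_comp_mul_left
    (fun v => stableKernel γ (α * v) * Real.exp (-(x ^ (1 / α) * Real.exp v))) δ,
    integral_stableKernel_one_sub hα (by positivity), ← Real.rpow_mul hx.le,
    one_div_mul_cancel hα0.ne', Real.rpow_one, abs_of_pos (inv_pos.2 hδ0), hδ, inv_div, smul_eq_mul]

/-! ### Existence of positive stable laws -/

theorem integral_stableKernel {γ : ℝ} (hγ : γ ∈ Ioo (0 : ℝ) 1) :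
    ∫ x, stableKernel γ (γ * x) = 1 := by
  have hk := integrable_stableKernel_mul hγ hγ.1.ne'
  have h1 : Filter.Tendsto (fun q : ℝ => ∫ x, stableKernel γ (γ * x) * (q / (Real.exp x + q)))
      Filter.atTop (nhds (∫ x, stableKernel γ (γ * x))) := by
    refine tendsto_integral_filter_of_dominated_convergence
      (fun x => ‖stableKernel γ (γ * x)‖) ?_ ?_ hk.norm ?_
    · refine Filter.Eventually.of_forall fun q => ?_
      exact hk.aestronglyMeasurable.mul (by fun_prop : Measurable _).aestronglyMeasurable
    · filter_upwards [Filter.eventually_gt_atTop 0] with q hq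
      refine Filter.Eventually.of_forall fun x => ?_
      rw [norm_mul, Real.norm_of_nonneg (by positivity : 0 ≤ q / (Real.exp x + q))]
      refine mul_le_of_le_one_right (norm_nonneg _) ?_
      rw [div_le_one (by positivity)]
      linarith [Real.exp_pos x]
    · refine Filter.Eventually.of_forall fun x => ?_
      have h2 : Filter.Tendsto (fun q : ℝ => 1 - Real.exp x / (Real.exp x + q)) Filter.atTop
          (nhds (1 - 0)) :=
        tendsto_const_nhds.sub (Filter.Tendsto.const_div_atTop
          (Filter.tendsto_atTop_add_const_left _ _ Filter.tendsto_id) _)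
      have h3 : Filter.Tendsto (fun q : ℝ => q / (Real.exp x + q)) Filter.atTop (nhds 1) := by
        rw [sub_zero] at h2
        refine h2.congr' ?_
        filter_upwards [Filter.eventually_gt_atTop 0] with q hq
        have : Real.exp x + q ≠ 0 := by positivity
        field_simp
        ring
      simpa using h3.const_mul (stableKernel γ (γ * x))
  have h4 : Filter.Tendsto (fun q : ℝ => 1 - 1 / (q ^ γ + 1)) Filter.atTop (nhds (1 - 0)) :=
    tendsto_const_nhds.sub (Filter.Tendsto.const_div_atTop
      (Filter.tendsto_atTop_add_const_right _ _ (tendsto_rpow_atTop hγ.1)) _)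
  rw [sub_zero] at h4
  refine tendsto_nhds_unique (h1.congr' ?_) h4
  filter_upwards [Filter.eventually_gt_atTop 0] with q hq
  have h5 : ∀ x, stableKernel γ (γ * x) * (q / (Real.exp x + q))
      = q * (stableKernel γ (γ * x) / (Real.exp x + q)) := fun x => by ring
  simp_rw [h5]
  rw [integral_const_mul, integral_stableKernel_div hγ hq, Real.rpow_sub_one hq.ne']
  have : q ^ γ + 1 ≠ 0 := by positivity
  field_simp
  ring

/-- The function `1 / (1 + l ^ β)` is the Laplace transform of a probability measure, a mixture of
exponential laws. -/
theorem exists_laplace_eq_inv_one_add_rpow {β : ℝ} (hβ : β ∈ Ioo (0 : ℝ) 1) :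
    ∃ ρ : Measure ℝ, IsProbabilityMeasure ρ ∧ (∀ᵐ t ∂ρ, 0 ≤ t) ∧
      ∀ l : ℝ, 0 ≤ l → ∫ t, Real.exp (-(l * t)) ∂ρ = (1 + l ^ β)⁻¹ := by
  have hk := integrable_stableKernel_mul hβ hβ.1.ne'
  have hkm : Measurable (stableKernel β) := (continuous_stableKernel hβ).measurable
  have hk0 : ∀ x, 0 ≤ stableKernel β (β * x) := fun x => (stableKernel_pos hβ _).le
  set u : ℝ → ENNReal := fun s =>
    ∫⁻ x, ENNReal.ofReal (stableKernel β (β * x) * Real.exp x * Real.exp (-(s * Real.exp x)))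
    with hu
  have hum : Measurable u := by
    refine Measurable.lintegral_prod_right' (f := fun q : ℝ × ℝ => ENNReal.ofReal
      (stableKernel β (β * q.2) * Real.exp q.2 * Real.exp (-(q.1 * Real.exp q.2)))) ?_
    fun_prop
  set ρ := (volume.restrict (Ioi (0 : ℝ))).withDensity u with hρ
  have hlin : ∀ l : ℝ, 0 ≤ l → ∫⁻ t, ENNReal.ofReal (Real.exp (-(l * t))) ∂ρ
      = ENNReal.ofReal (1 + l ^ β)⁻¹ := by
    intro l hl
    have h1 : ∀ s, (u * fun t => ENNReal.ofReal (Real.exp (-(l * t)))) s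
        = ∫⁻ x, ENNReal.ofReal (stableKernel β (β * x) * Real.exp x
          * Real.exp (-((Real.exp x + l) * s))) := by
      intro s
      simp only [Pi.mul_apply, hu]
      rw [← lintegral_mul_const' _ _ ENNReal.ofReal_ne_top]
      refine lintegral_congr fun x => ?_
      rw [← ENNReal.ofReal_mul (mul_nonneg (mul_nonneg (hk0 x) (Real.exp_pos _).le)
        (Real.exp_pos _).le), mul_assoc _ (Real.exp _) (Real.exp _), ← Real.exp_add]
      congr 3; ring
    have h2 : ∀ x, ∫⁻ s in Ioi 0, ENNReal.ofReal (stableKernel β (β * x) * Real.exp x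
          * Real.exp (-((Real.exp x + l) * s)))
        = ENNReal.ofReal (stableKernel β (β * x) - l * (stableKernel β (β * x)
          / (Real.exp x + l))) := by
      intro x
      have hpos : 0 < Real.exp x + l := by positivity
      rw [lintegral_Ioi_mul_exp_neg_mul hpos (mul_nonneg (hk0 x) (Real.exp_pos _).le)]
      congr 1
      field_simp
      ring
    have hnn : ∀ x, 0 ≤ stableKernel β (β * x) - l * (stableKernel β (β * x)
          / (Real.exp x + l)) := by
      intro x
      have hpos : 0 < Real.exp x + l := by positivity
      have : stableKernel β (β * x) - l * (stableKernel β (β * x) / (Real.exp x + l))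
          = stableKernel β (β * x) * (Real.exp x / (Real.exp x + l)) := by
        field_simp
        ring
      rw [this]
      exact mul_nonneg (hk0 x) (by positivity)
    rw [hρ, lintegral_withDensity_eq_lintegral_mul _ hum (by fun_prop), lintegral_congr h1,
      lintegral_lintegral_swap (by fun_prop), lintegral_congr h2]
    rcases hl.eq_or_lt with rfl | hl0
    · simp only [zero_mul, sub_zero]
      rw [← ofReal_integral_eq_lintegral_ofReal hk (Filter.Eventually.of_forall hk0),
        integral_stableKernel hβ, Real.zero_rpow hβ.1.ne']
      norm_num
    · have hd := (integrable_div_exp_add hk hl0).const_mul l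
      have h3 := ofReal_integral_eq_lintegral_ofReal (hk.sub hd) (Filter.Eventually.of_forall hnn)
      simp only [Pi.sub_apply] at h3
      rw [← h3]
      congr 1
      rw [integral_sub hk hd, integral_const_mul,
        integral_stableKernel_div hβ hl0, integral_stableKernel hβ, Real.rpow_sub_one hl0.ne']
      have : l ^ β + 1 ≠ 0 := by positivity
      have : 1 + l ^ β ≠ 0 := by positivity
      field_simp
      ring
  refine ⟨ρ, ⟨?_⟩, ?_, fun l hl => ?_⟩
  · have := hlin 0 le_rfl
    rw [Real.zero_rpow hβ.1.ne'] at this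
    simpa using this
  · refine (withDensity_absolutelyContinuous _ _).ae_le ?_
    filter_upwards [self_mem_ae_restrict measurableSet_Ioi] with t ht using le_of_lt ht
  · rw [integral_eq_lintegral_of_nonneg_ae (Filter.Eventually.of_forall fun t =>
      (Real.exp_pos _).le) (by fun_prop), hlin l hl, ENNReal.toReal_ofReal (by positivity)]

/-- Convolution powers raise the Laplace transform to a power. -/
theorem exists_laplace_eq_pow (ρ : Measure ℝ) [IsProbabilityMeasure ρ] (hρ : ∀ᵐ t ∂ρ, 0 ≤ t)
    (n : ℕ) :
    ∃ σ : Measure ℝ, IsProbabilityMeasure σ ∧ (∀ᵐ t ∂σ, 0 ≤ t) ∧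
      ∀ l : ℝ, ∫ t, Real.exp (-(l * t)) ∂σ = (∫ t, Real.exp (-(l * t)) ∂ρ) ^ n := by
  induction n with
  | zero =>
    refine ⟨Measure.dirac 0, inferInstance, ?_, fun l => by simp⟩
    rw [ae_dirac_eq]
    exact le_refl (0 : ℝ)
  | succ n ih =>
    obtain ⟨σ, hσ, hσ0, hσl⟩ := ih
    refine ⟨(σ.prod ρ).map fun q => q.1 + q.2,
      Measure.isProbabilityMeasure_map (by fun_prop), ?_, fun l => ?_⟩
    · rw [ae_map_iff (by fun_prop) measurableSet_Ici]
      filter_upwards [Measure.quasiMeasurePreserving_fst.ae hσ0,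
        Measure.quasiMeasurePreserving_snd.ae hρ] with q h1 h2
      exact add_nonneg h1 h2
    · rw [integral_map (by fun_prop) (by fun_prop)]
      have : ∀ q : ℝ × ℝ, Real.exp (-(l * (q.1 + q.2)))
          = Real.exp (-(l * q.1)) * Real.exp (-(l * q.2)) := by
        intro q
        rw [← Real.exp_add]; congr 1; ring
      simp_rw [this]
      rw [integral_prod_mul (fun t => Real.exp (-(l * t))) (fun t => Real.exp (-(l * t))), hσl,
        pow_succ]

theorem exists_laplace_eq_inv_pow {β : ℝ} (hβ : β ∈ Ioo (0 : ℝ) 1) {n : ℕ} (hn : n ≠ 0) :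
    ∃ σ : Measure ℝ, IsProbabilityMeasure σ ∧ (∀ᵐ t ∂σ, 0 ≤ t) ∧
      ∀ l : ℝ, 0 ≤ l → ∫ t, Real.exp (-(l * t)) ∂σ = ((1 + l ^ β / n) ^ n)⁻¹ := by
  obtain ⟨ρ, hρ, hρ0, hρl⟩ := exists_laplace_eq_inv_one_add_rpow hβ
  have hn0 : (0 : ℝ) < n := by positivity
  set c : ℝ := (1 / n : ℝ) ^ (1 / β) with hc
  have hc0 : 0 < c := by positivity
  have hcβ : c ^ β = 1 / n := by
    rw [hc, ← Real.rpow_mul (by positivity), one_div_mul_cancel hβ.1.ne', Real.rpow_one]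
  have hmap : IsProbabilityMeasure (ρ.map fun t => c * t) :=
    Measure.isProbabilityMeasure_map (by fun_prop)
  obtain ⟨σ, hσ, hσ0, hσl⟩ := exists_laplace_eq_pow (ρ.map fun t => c * t) (by
    rw [ae_map_iff (by fun_prop) measurableSet_Ici]
    filter_upwards [hρ0] with t ht
    exact mul_nonneg hc0.le ht) n
  refine ⟨σ, hσ, hσ0, fun l hl => ?_⟩
  rw [hσl, integral_map (by fun_prop) (by fun_prop)]
  simp_rw [← mul_assoc]
  rw [hρl _ (by positivity), Real.mul_rpow hl hc0.le, hcβ, inv_pow, mul_one_div]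

/-- Weak limits in the variable `e ^ (-t)`, which ranges over the compact interval `[0, 1]`. -/
theorem exists_limit_rpow {F : ℕ → ℝ → ℝ} {G : ℝ → ℝ}
    (h : ∀ n, ∃ σ : Measure ℝ, IsProbabilityMeasure σ ∧ (∀ᵐ t ∂σ, 0 ≤ t) ∧
      ∀ l : ℝ, 0 ≤ l → ∫ t, Real.exp (-(l * t)) ∂σ = F n l)
    (hF : ∀ l, 0 < l → Filter.Tendsto (fun n => F n l) Filter.atTop (nhds (G l))) :
    ∃ r : Measure unitInterval, IsProbabilityMeasure r ∧
      ∀ l : ℝ, 0 < l → ∫ y, (y : ℝ) ^ l ∂r = G l := by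
  choose σ hσ hσ0 hσl using h
  set g : ℝ → unitInterval := fun t => projIcc 0 1 zero_le_one (Real.exp (-t)) with hg
  have hgm : Measurable g := (continuous_projIcc.comp (by fun_prop)).measurable
  let R : ℕ → ProbabilityMeasure unitInterval := fun n =>
    ⟨(σ n).map g, Measure.isProbabilityMeasure_map hgm.aemeasurable⟩
  let U : Ultrafilter (ProbabilityMeasure unitInterval) := (Filter.hyperfilter ℕ).map R
  obtain ⟨r, -, hr⟩ := isCompact_univ.ultrafilter_le_nhds U (by simp)
  have hr' : Filter.Tendsto R (Filter.hyperfilter ℕ : Filter ℕ) (nhds r) := hr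
  refine ⟨r, inferInstance, fun l hl => ?_⟩
  have hcont : Continuous fun y : unitInterval => (y : ℝ) ^ l :=
    (Real.continuous_rpow_const hl.le).comp continuous_subtype_val
  have ht := (ProbabilityMeasure.tendsto_iff_forall_integral_tendsto.1 hr')
    (BoundedContinuousFunction.mkOfCompact ⟨fun y : unitInterval => (y : ℝ) ^ l, hcont⟩)
  refine tendsto_nhds_unique ht (((hF l hl).mono_left Nat.hyperfilter_le_atTop).congr
    fun n => ?_)
  simp only [BoundedContinuousFunction.mkOfCompact_apply, ContinuousMap.coe_mk]
  change F n l = ∫ y : unitInterval, (y : ℝ) ^ l ∂((σ n).map g)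
  rw [integral_map hgm.aemeasurable hcont.aestronglyMeasurable, ← hσl n l hl.le]
  refine integral_congr_ae ?_
  filter_upwards [hσ0 n] with t ht
  have : ((g t : unitInterval) : ℝ) = Real.exp (-t) := by
    rw [hg]
    simp only
    rw [projIcc_of_mem zero_le_one ⟨(Real.exp_pos _).le, Real.exp_le_one_iff.2 (by linarith)⟩]
  rw [this, ← Real.exp_mul]
  congr 1; ring

theorem isPositiveStableLaw_dirac_one : IsPositiveStableLaw 1 (Measure.dirac 1) where
  isProbabilityMeasure := inferInstance
  pos := by simp
  laplace := fun l _ => by simp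

/-- Positive stable laws exist for every index in `(0, 1]`: below index one, `exp (-l ^ β)` is the
limit of the Laplace transforms `(1 + l ^ β / n) ^ (-n)`. -/
theorem exists_isPositiveStableLaw {β : ℝ} (hβ : β ∈ Ioc (0 : ℝ) 1) :
    ∃ ν : Measure ℝ, IsPositiveStableLaw β ν := by
  rcases hβ.2.eq_or_lt with rfl | hβ1
  · exact ⟨_, isPositiveStableLaw_dirac_one⟩
  have hβ0 := hβ.1
  obtain ⟨r, hr, hrl⟩ := exists_limit_rpow
    (F := fun n l => ((1 + l ^ β / ((n + 1 : ℕ) : ℝ)) ^ (n + 1))⁻¹)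
    (G := fun l => Real.exp (-(l ^ β)))
    (fun n => exists_laplace_eq_inv_pow ⟨hβ0, hβ1⟩ n.succ_ne_zero) (fun l hl => by
      rw [Real.exp_neg]
      exact (((Real.tendsto_one_add_div_pow_exp (l ^ β)).comp
        (Filter.tendsto_add_atTop_nat 1)).inv₀ (Real.exp_pos _).ne'))
  have hcont : ∀ l : ℝ, 0 < l → Continuous fun y : unitInterval => (y : ℝ) ^ l := fun l hl =>
    (Real.continuous_rpow_const hl.le).comp continuous_subtype_val
  have hint : ∀ l : ℝ, 0 < l → Integrable (fun y : unitInterval => (y : ℝ) ^ l) r := fun l hl =>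
    (hcont l hl).integrable_of_hasCompactSupport (HasCompactSupport.of_compactSpace _)
  -- no mass at `y = 0`, by continuity of the transform at the origin
  have hr0 : r {0} = 0 := by
    have hle : r.real {0} ≤ 0 := by
      refine le_of_forall_pos_le_add fun L hL => ?_
      have hl : 0 < L ^ (1 / β) := by positivity
      have h1 : r.real {0} = ∫ y, ({0} : Set unitInterval).indicator 1 y ∂r := by
        rw [integral_indicator_one (measurableSet_singleton _)]
      have h2 : ∫ y, ({0} : Set unitInterval).indicator 1 y ∂r
          ≤ ∫ y : unitInterval, (1 - (y : ℝ) ^ (L ^ (1 / β))) ∂r := by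
        refine integral_mono ((integrable_const (1 : ℝ)).indicator (measurableSet_singleton _))
          ((integrable_const _).sub (hint _ hl)) fun y => ?_
        by_cases hy : y = 0
        · subst hy
          have h0 : ((0 : unitInterval) : ℝ) ^ (L ^ (1 / β)) = 0 := Real.zero_rpow hl.ne'
          simp only [h0]
          simp
        · rw [indicator_of_notMem (by simpa using hy)]
          simpa using Real.rpow_le_one y.2.1 y.2.2 hl.le
      rw [integral_sub (integrable_const _) (hint _ hl), hrl _ hl, ← Real.rpow_mul hL.le,
        one_div_mul_cancel hβ0.ne', Real.rpow_one] at h2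
      have h3 := Real.add_one_le_exp (-L)
      simp only [integral_const, probReal_univ, smul_eq_mul, mul_one] at h2
      rw [h1]
      linarith
    exact (measureReal_eq_zero_iff (by finiteness)).1 (le_antisymm hle measureReal_nonneg)
  -- no mass at `y = 1`, since the transform vanishes at infinity
  have hr1 : r {1} = 0 := by
    have hle : r.real {1} ≤ 0 := by
      refine ge_of_tendsto Real.tendsto_exp_neg_atTop_nhds_zero ?_
      filter_upwards [Filter.eventually_gt_atTop 0] with L hL
      have hl : 0 < L ^ (1 / β) := by positivity
      have h1 : r.real {1} = ∫ y, ({1} : Set unitInterval).indicator 1 y ∂r := by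
        rw [integral_indicator_one (measurableSet_singleton _)]
      have h2 : ∫ y, ({1} : Set unitInterval).indicator 1 y ∂r
          ≤ ∫ y : unitInterval, (y : ℝ) ^ (L ^ (1 / β)) ∂r := by
        refine integral_mono ((integrable_const (1 : ℝ)).indicator (measurableSet_singleton _))
          (hint _ hl) fun y => ?_
        by_cases hy : y = 1
        · subst hy
          simp
        · rw [indicator_of_notMem (by simpa using hy)]
          exact Real.rpow_nonneg y.2.1 _
      rw [hrl _ hl, ← Real.rpow_mul hL.le, one_div_mul_cancel hβ0.ne', Real.rpow_one] at h2
      rw [h1]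
      exact h2
    exact (measureReal_eq_zero_iff (by finiteness)).1 (le_antisymm hle measureReal_nonneg)
  have hae : ∀ᵐ y : unitInterval ∂r, 0 < (y : ℝ) ∧ (y : ℝ) < 1 := by
    filter_upwards [measure_eq_zero_iff_ae_notMem.1 hr0, measure_eq_zero_iff_ae_notMem.1 hr1]
      with y h0 h1
    refine ⟨lt_of_le_of_ne y.2.1 fun h => h0 ?_, lt_of_le_of_ne y.2.2 fun h => h1 ?_⟩
    · exact Subtype.ext h.symm
    · exact Subtype.ext h
  have hm : Measurable fun y : unitInterval => -Real.log (y : ℝ) := by fun_prop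
  refine ⟨r.map fun y : unitInterval => -Real.log (y : ℝ), Measure.isProbabilityMeasure_map hm.aemeasurable,
    ?_, fun l hl => ?_⟩
  · rw [Measure.map_apply hm measurableSet_Iic, measure_eq_zero_iff_ae_notMem]
    filter_upwards [hae] with y hy
    have := Real.log_neg hy.1 hy.2
    simp only [mem_preimage, mem_Iic, not_le]
    linarith
  · rcases hl.eq_or_lt with rfl | hl0
    · have := Measure.isProbabilityMeasure_map (μ := r) hm.aemeasurable
      simp [Real.zero_rpow hβ0.ne']
    · rw [integral_map hm.aemeasurable (by fun_prop), ← hrl l hl0]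
      refine integral_congr_ae ?_
      filter_upwards [hae] with y hy
      rw [Real.rpow_def_of_pos hy.1]
      congr 1; ring

/-! ### Bernstein measures and complete monotonicity -/

theorem IsBernsteinMeasure.ae_nonneg {f : ℝ → ℝ} {μ : Measure ℝ} (h : IsBernsteinMeasure f μ) :
    ∀ᵐ t ∂μ, 0 ≤ t := by
  rw [ae_iff]
  simp only [not_le]
  exact h.nonneg

theorem IsBernsteinMeasure.lintegral {f : ℝ → ℝ} {μ : Measure ℝ} (h : IsBernsteinMeasure f μ)
    {p : ℝ} (hp : 0 < p) :
    ∫⁻ t, ENNReal.ofReal (Real.exp (-(p * t))) ∂μ = ENNReal.ofReal (f p) := by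
  rw [← h.laplace p hp, ofReal_integral_eq_lintegral_ofReal (h.integrable p hp)
    (Filter.Eventually.of_forall fun t => (Real.exp_pos _).le)]

theorem IsBernsteinMeasure.unique {f : ℝ → ℝ} {μ ν : Measure ℝ} (hμ : IsBernsteinMeasure f μ)
    (hν : IsBernsteinMeasure f ν) : μ = ν :=
  ext_of_laplace (c := 0) (fun p hp => hμ.lintegral hp ▸ ENNReal.ofReal_ne_top) fun p hp => by
    rw [hμ.lintegral hp, hν.lintegral hp]

/-- The easy half of Bernstein's theorem: differentiate under the integral sign. -/
theorem IsBernsteinMeasure.isCompletelyMonotone {f : ℝ → ℝ} {μ : Measure ℝ}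
    (h : IsBernsteinMeasure f μ) : IsCompletelyMonotone f := by
  have hsub : Ioi 0 ⊆ interior (integrableExpSet (fun t : ℝ => -t) μ) :=
    interior_maximal (fun x hx => by simpa [integrableExpSet] using h.integrable x hx) isOpen_Ioi
  have hf : EqOn f (mgf (fun t : ℝ => -t) μ) (Ioi 0) := fun x hx => by
    rw [← h.laplace x hx]
    simp [mgf]
  refine ⟨?_, fun n x hx => ?_⟩
  · exact (((analyticOnNhd_mgf.mono hsub).contDiffOn (uniqueDiffOn_Ioi 0)).congr hf)
  · rw [(hf.eventuallyEq_of_mem (Ioi_mem_nhds hx)).iteratedDeriv_eq n,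
      iteratedDeriv_mgf (hsub hx), ← integral_const_mul]
    refine integral_nonneg_of_ae ?_
    filter_upwards [h.ae_nonneg] with t ht
    simp only [Pi.zero_apply]
    rw [← mul_assoc, ← mul_pow, neg_one_mul, neg_neg]
    positivity

theorem IsCompletelyMonotone.convexOn {f : ℝ → ℝ} (hf : IsCompletelyMonotone f) :
    ConvexOn ℝ (Ioi 0) f := by
  have hd : DifferentiableOn ℝ f (Ioi 0) := hf.1.differentiableOn (by simp)
  have hd2 : DifferentiableOn ℝ (deriv f) (Ioi 0) :=
    (hf.1.deriv_of_isOpen (m := 1) isOpen_Ioi (by norm_cast)).differentiableOn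
      one_ne_zero
  refine convexOn_of_deriv2_nonneg (convex_Ioi 0) hd.continuousOn ?_ ?_ ?_
  · rwa [interior_Ioi]
  · rwa [interior_Ioi]
  · intro x hx
    rw [interior_Ioi] at hx
    have := hf.2 2 x hx
    rw [iteratedDeriv_eq_iterate] at this
    simpa using this

/-- The Mittag-Leffler function to second order at the origin, with a nonnegative cubic
remainder. -/
theorem exists_mittagLeffler_expansion {α : ℝ} (hα : 0 < α) :
    ∃ (b c C : ℝ) (r : ℝ → ℝ), 0 < c ∧ (∀ x, 0 ≤ x → 0 ≤ r x) ∧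
      (∀ x, 0 ≤ x → x ≤ 1 → r x ≤ C * x ^ 3) ∧
      ∀ x, mittagLeffler α x = 1 + b * x + c * x ^ 2 + r x := by
  have hG : ∀ n : ℕ, 0 < Real.Gamma (1 + α * n) := fun n =>
    Real.Gamma_pos_of_pos (by positivity)
  have hs : ∀ x, Summable fun n : ℕ => x ^ (n + 3) / Real.Gamma (1 + α * (n + 3 : ℕ)) := fun x =>
    (summable_nat_add_iff 3).2 (summable_mittagLeffler hα x)
  refine ⟨(Real.Gamma (1 + α * (1 : ℕ)))⁻¹, (Real.Gamma (1 + α * (2 : ℕ)))⁻¹,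
    ∑' n : ℕ, 1 ^ (n + 3) / Real.Gamma (1 + α * (n + 3 : ℕ)),
    fun x => ∑' n : ℕ, x ^ (n + 3) / Real.Gamma (1 + α * (n + 3 : ℕ)), inv_pos.2 (hG 2),
    fun x hx => tsum_nonneg fun n => div_nonneg (by positivity) (hG _).le,
    fun x hx hx1 => ?_, fun x => ?_⟩
  · rw [← tsum_mul_right]
    refine (hs x).tsum_le_tsum (fun n => ?_) ((hs 1).mul_right _)
    rw [one_pow, div_mul_eq_mul_div, one_mul, pow_add]
    have := (hG (n + 3)).le
    gcongr
    exact mul_le_of_le_one_left (by positivity) (pow_le_one₀ hx hx1)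
  · rw [mittagLeffler, ← (summable_mittagLeffler hα x).sum_add_tsum_nat_add 3]
    simp only [Finset.sum_range_succ, Finset.sum_range_zero]
    simp [div_eq_inv_mul]

/-- For `α < 1 / 2` the exponential term is `o(x ^ 2)` up to its value at `0`, so that `f_α` is
strictly concave near the origin because of the quadratic term of the Mittag-Leffler series. -/
theorem half_le_of_isCompletelyMonotone {α : ℝ} (hα : 0 < α)
    (h : IsCompletelyMonotone fun x => Real.exp (x ^ (1 / α)) / α - mittagLeffler α x) :
    1 / 2 ≤ α := by
  by_contra! hlt
  obtain ⟨b, c, C, r, hc, hr0, hrC, hE⟩ := exists_mittagLeffler_expansion hα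
  set κ := 1 / α with hκ
  have hκ2 : 2 < κ := by
    rw [hκ, lt_div_iff₀ hα]; linarith
  have hcv := h.convexOn
  have key : ∀ t ∈ Ioo (0 : ℝ) (1 / 3),
      2 * c ≤ 2 / α * 3 ^ κ * t ^ (κ - 2) + 16 * C * t := by
    intro t ht
    have ht0 : 0 < t := ht.1
    have ht3 : 3 * t < 1 := by linarith [ht.2]
    have hmid := hcv.2 (mem_Ioi.2 ht0) (mem_Ioi.2 (by positivity : 0 < 3 * t))
      (by norm_num : (0 : ℝ) ≤ 1 / 2) (by norm_num : (0 : ℝ) ≤ 1 / 2) (by norm_num)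
    simp only [smul_eq_mul] at hmid
    rw [show 1 / 2 * t + 1 / 2 * (3 * t) = 2 * t by ring, hE, hE, hE] at hmid
    have e1 : Real.exp (t ^ κ) ≤ Real.exp ((2 * t) ^ κ) := by
      apply Real.exp_le_exp.2
      exact Real.rpow_le_rpow ht0.le (by linarith) (by linarith)
    have e2 : 1 ≤ Real.exp ((2 * t) ^ κ) := Real.one_le_exp (by positivity)
    have e3 : Real.exp ((3 * t) ^ κ) - 1 ≤ 2 * (3 * t) ^ κ := by
      have h1 : (3 * t) ^ κ ≤ 1 := Real.rpow_le_one (by positivity) ht3.le (by linarith)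
      have h0 : 0 ≤ (3 * t) ^ κ := by positivity
      have := Real.abs_exp_sub_one_le (x := (3 * t) ^ κ) (by rwa [abs_of_nonneg h0])
      rw [abs_of_nonneg h0] at this
      exact (le_abs_self _).trans this
    have e4 : (Real.exp (t ^ κ) + Real.exp ((3 * t) ^ κ) - 2 * Real.exp ((2 * t) ^ κ)) / α
        ≤ 2 * (3 * t) ^ κ / α := by
      gcongr
      linarith
    have r1 := hr0 t ht0.le
    have r2 := hr0 (3 * t) (by positivity)
    have r3 := hrC (2 * t) (by positivity) (by linarith)
    have hsum : 2 * c * t ^ 2 ≤ 2 * (3 * t) ^ κ / α + 16 * C * t ^ 3 := by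
      have e5 : (Real.exp (t ^ κ) + Real.exp ((3 * t) ^ κ) - 2 * Real.exp ((2 * t) ^ κ)) / α
          = Real.exp (t ^ κ) / α + Real.exp ((3 * t) ^ κ) / α
            - 2 * (Real.exp ((2 * t) ^ κ) / α) := by ring
      rw [e5] at e4
      nlinarith
    have hpow : (3 * t) ^ κ = 3 ^ κ * t ^ (κ - 2) * t ^ 2 := by
      rw [Real.mul_rpow (by norm_num) ht0.le, mul_assoc]
      congr 1
      rw [← Real.rpow_natCast, ← Real.rpow_add ht0]
      norm_num
    rw [hpow] at hsum
    have ht2 : 0 < t ^ 2 := by positivity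
    refine le_of_mul_le_mul_right (hsum.trans_eq ?_) ht2
    ring
  have hlim : Filter.Tendsto (fun t : ℝ => 2 / α * 3 ^ κ * t ^ (κ - 2) + 16 * C * t)
      (nhdsWithin 0 (Ioi 0)) (nhds 0) := by
    have hc1 : Continuous fun t : ℝ => 2 / α * 3 ^ κ * t ^ (κ - 2) + 16 * C * t :=
      (continuous_const.mul (Real.continuous_rpow_const (by linarith))).add (by fun_prop)
    have := (hc1.tendsto 0).mono_left (nhdsWithin_le_nhds (s := Ioi 0))
    simpa [Real.zero_rpow (by linarith : κ - 2 ≠ 0)] using this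
  have hle : 2 * c ≤ 0 := by
    refine ge_of_tendsto hlim ?_
    filter_upwards [Ioo_mem_nhdsGT (by norm_num : (0 : ℝ) < 1 / 3)] with t ht using key t ht
  linarith

/-- The Bernstein measure of `f_α`, as a multiple of the law of `(Z₁ / Z₂) ^ (1 - α)`. -/
theorem isBernsteinMeasure_map_prod {α : ℝ} {ν₁ ν₂ : Measure ℝ} (hα : α ∈ Ioo (0 : ℝ) 1)
    (h₁ : IsPositiveStableLaw ((1 - α) / α) ν₁) (h₂ : IsPositiveStableLaw (1 - α) ν₂) :
    IsBernsteinMeasure (fun x => Real.exp (x ^ (1 / α)) / α - mittagLeffler α x)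
      (ENNReal.ofReal (1 / α - 1) • (ν₁.prod ν₂).map fun q => (q.1 / q.2) ^ (1 - α)) := by
  have hα0 := hα.1
  have hα1 : 0 < 1 - α := by linarith [hα.2]
  have := h₁.isProbabilityMeasure
  have := h₂.isProbabilityMeasure
  have hm : Measurable fun q : ℝ × ℝ => (q.1 / q.2) ^ (1 - α) := by fun_prop
  have hprob := Measure.isProbabilityMeasure_map (μ := ν₁.prod ν₂) hm.aemeasurable
  have hnn : ∀ᵐ t ∂((ν₁.prod ν₂).map fun q => (q.1 / q.2) ^ (1 - α)), 0 ≤ t := by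
    rw [ae_map_iff hm.aemeasurable measurableSet_Ici]
    filter_upwards [Measure.quasiMeasurePreserving_fst.ae h₁.ae_pos,
      Measure.quasiMeasurePreserving_snd.ae h₂.ae_pos] with q hq1 hq2
    positivity
  have hint : ∀ x : ℝ, 0 < x → Integrable (fun t => Real.exp (-(x * t)))
      ((ν₁.prod ν₂).map fun q => (q.1 / q.2) ^ (1 - α)) := by
    intro x hx
    refine Integrable.mono' (integrable_const (1 : ℝ)) (by fun_prop) ?_
    filter_upwards [hnn] with t ht
    rw [Real.norm_of_nonneg (Real.exp_pos _).le]
    exact Real.exp_le_one_iff.2 (neg_nonpos.2 (by positivity))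
  have hfin : IsFiniteMeasure
      (ENNReal.ofReal (1 / α - 1) • (ν₁.prod ν₂).map fun q => (q.1 / q.2) ^ (1 - α)) :=
    Measure.smul_finite _ ENNReal.ofReal_ne_top
  refine ⟨inferInstance, ?_, fun x hx => (hint x hx).smul_measure ENNReal.ofReal_ne_top,
    fun x hx => ?_⟩
  · rw [ae_iff] at hnn
    simp only [not_le] at hnn
    rw [Measure.smul_apply, show Iio (0 : ℝ) = {a | a < 0} from rfl, hnn, smul_zero]
  · have hmap : Integrable (fun q : ℝ × ℝ => Real.exp (-(x * (q.1 / q.2) ^ (1 - α))))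
        (ν₁.prod ν₂) := (integrable_map_measure (by fun_prop) hm.aemeasurable).1 (hint x hx)
    rw [integral_smul_measure, integral_map hm.aemeasurable (by fun_prop),
      integral_prod _ hmap, integral_exp_neg_mul_div_rpow hα h₁ h₂ hx,
      ENNReal.toReal_ofReal (by rw [sub_nonneg, le_div_iff₀ hα0]; linarith), smul_eq_mul]
    field_simp

theorem proposition1 (α : ℝ) (hα : α ∈ Set.Ioo (0 : ℝ) 1) :
    (IsCompletelyMonotone (fun x => Real.exp (x ^ (1 / α)) / α - mittagLeffler α x) ↔
      1 / 2 ≤ α) ∧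
    (1 / 2 ≤ α →
      (∃ ν₁ : MeasureTheory.Measure ℝ, IsPositiveStableLaw ((1 - α) / α) ν₁) ∧
      (∃ ν₂ : MeasureTheory.Measure ℝ, IsPositiveStableLaw (1 - α) ν₂) ∧
      ∀ {Ω : Type*} [MeasurableSpace Ω] (P : MeasureTheory.Measure Ω)
        [MeasureTheory.IsProbabilityMeasure P] (Z₁ Z₂ : Ω → ℝ),
        AEMeasurable Z₁ P → AEMeasurable Z₂ P →
        ProbabilityTheory.IndepFun Z₁ Z₂ P →
        IsPositiveStableLaw ((1 - α) / α) (P.map Z₁) →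
        IsPositiveStableLaw (1 - α) (P.map Z₂) →
        ∀ μ : MeasureTheory.Measure ℝ,
          IsBernsteinMeasure (fun x => Real.exp (x ^ (1 / α)) / α - mittagLeffler α x) μ ↔
            μ = ENNReal.ofReal (1 / α - 1) •
              P.map (fun w => (Z₁ w / Z₂ w) ^ (1 - α))) := by
  have hα0 := hα.1
  have hex : 1 / 2 ≤ α → (∃ ν₁ : Measure ℝ, IsPositiveStableLaw ((1 - α) / α) ν₁) ∧
      ∃ ν₂ : Measure ℝ, IsPositiveStableLaw (1 - α) ν₂ := fun h =>
    ⟨exists_isPositiveStableLaw ⟨div_pos (by linarith [hα.2]) hα0,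
      by rw [div_le_one hα0]; linarith⟩,
      exists_isPositiveStableLaw ⟨by linarith [hα.2], by linarith⟩⟩
  refine ⟨⟨half_le_of_isCompletelyMonotone hα0, fun h => ?_⟩, fun h => ⟨(hex h).1, (hex h).2, ?_⟩⟩
  · obtain ⟨⟨ν₁, h₁⟩, ν₂, h₂⟩ := hex h
    exact (isBernsteinMeasure_map_prod hα h₁ h₂).isCompletelyMonotone
  · intro Ω _ P _ Z₁ Z₂ hZ₁ hZ₂ hind h₁ h₂ μ
    have hB := isBernsteinMeasure_map_prod hα h₁ h₂
    have hm : Measurable fun q : ℝ × ℝ => (q.1 / q.2) ^ (1 - α) := by fun_prop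
    rw [← (indepFun_iff_map_prod_eq_prod_map_map hZ₁ hZ₂).1 hind,
      AEMeasurable.map_map_of_aemeasurable hm.aemeasurable (hZ₁.prodMk hZ₂)] at hB
    exact ⟨fun hμ => hμ.unique hB, fun hμ => hμ ▸ hB⟩
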